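/- Let $X$ be a connected finite polyhedron (a connected space with a triangulation by a finite simplicial complex), let $p:\tilde X\to X$ be its universal covering and let $\pi=\pi_1(X)$, regarded as the group of covering transformations of $p$. Let $D_n(X)$ be the unordered configuration space of $n$ distinct points of $X$ (the quotient, by reordering, of the subspace of $X^n$ of $n$-tuples of distinct points), and let $F_n(\tilde X,\pi)=\{(\tilde x_1,\dots,\tilde x_n)\in\tilde X^n : p(\tilde x_i)\ne p(\tilde x_j)\text{ for } i\ne j\}$, with the map $p^n:F_n(\tilde X,\pi)\to D_n(X)$ that applies $p$ to each coordinate. An $n$-valued map is a continuous map $f:X\to D_n(X)$; a lifting of $f$ is a continuous map $\tilde f=(\tilde f_1,\dots,\tilde f_n):\tilde X\to F_n(\tilde X,\pi)$ with $p^n\circ\tilde f=f\circ p$; and $\mathrm{Fix}(f)=\{x\in X: x\in f(x)\}$. The group $\pi^n\rtimes\Sigma_n$ acts on $F_n(\tilde X,\pi)$ by $(\alpha_1,\dots,\alpha_n;\sigma)\cdot(\tilde x_1,\dots,\tilde x_n)=(\alpha_1\tilde x_{\sigma^{-1}(1)},\dots,\alpha_n\tilde x_{\sigma^{-1}(n)})$,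 and $\tilde f_\#=(\phi_1,\dots,\phi_n;\sigma):\pi\to\pi^n\rtimes\Sigma_n$ is determined by $\tilde f\circ\gamma=\tilde f_\#(\gamma)\circ\tilde f$ for all $\gamma\in\pi$. The set $\mathcal R(\tilde f_\#)$ of Reidemeister classes is the quotient of $\pi\times\{1,\dots,n\}$ by the equivalence relation in which $(\alpha,k)\sim(\beta,j)$ if and only if there is $\gamma\in\pi$ with $\sigma_\gamma(k)=j$ and $\alpha=\phi_j(\gamma)^{-1}\beta\gamma$. The Reidemeister trace of $f$ and $\tilde f$ is $$RT(f,\tilde f)=\sum_{[(\alpha,k)]\in\mathcal R(\tilde f_\#)}\mathrm{ind}(f,U_{[(\alpha,k)]})\,[(\alpha,k)]\in\mathbb Z\mathcal R(\tilde f_\#),$$ where $U_{[(\alpha,k)]}\subset X$ is an open set containing $p\,\mathrm{Fix}(\alpha^{-1}\tilde f_k)$ and no other fixed points of $f$, and $\mathrm{ind}(f,U)$ denotes the fixed point index of the $n$-valued map $f$ on $U$, that is, the classical fixed point index of the single-valued branch of $f$ that passes through the fixed points in $U$ (near them, $f$ has such a branch). **Theorem (homotopy invariance).** Let $f,g:X\to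 D_n(X)$ be $n$-valued maps that are homotopic by a homotopy $H:X\times[0,1]\to D_n(X)$. Let $\tilde f$ be a lifting of $f$, and let $\tilde g$ be the lifting of $g$ obtained by lifting the homotopy, starting at $\tilde f$; that is, there is a homotopy $\tilde H:\tilde X\times[0,1]\to F_n(\tilde X,\pi)$ from $\tilde f$ to $\tilde g$ with $p^n(\tilde H(\tilde x,t))=H(p(\tilde x),t)$ for all $\tilde x$ and $t$. Then $\tilde f_\#=\tilde g_\#$, and under the resulting identification of $\mathbb Z\mathcal R(\tilde f_\#)$ with $\mathbb Z\mathcal R(\tilde g_\#)$ (sending $[(\alpha,k)]$ to $[(\alpha,k)]$) we have $$RT(f,\tilde f)=RT(g,\tilde g).$$ -/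

import Mathlib

open scoped ContDiff

namespace NValued

/-! ### Configuration spaces and `n`-valued maps -/

section Configurations

/-- The ordered configuration space `F_n(Y)`, with the subspace topology from `Y ^ n`. -/
abbrev OrdConf (n : ℕ) (Y : Type*) : Type _ :=
  {y : Fin n → Y // Function.Injective y}

/-- Two ordered configurations are equivalent if they differ by a reordering. -/
def reorderSetoid (n : ℕ) (Y : Type*) : Setoid (OrdConf n Y) where
  r y z := ∃ σ : Equiv.Perm (Fin n), z.1 = y.1 ∘ σ
  iseqv :=
    { refl := fun y => ⟨1, by simp⟩
      symm := by
        rintro y z ⟨σ, h⟩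
        exact ⟨σ⁻¹, by rw [h]; funext i; simp⟩
      trans := by
        rintro x y z ⟨σ, h⟩ ⟨τ, h'⟩
        exact ⟨σ * τ, by rw [h', h]; funext i; simp⟩ }

/-- The unordered configuration space `D_n(Y)`, with the quotient topology. A continuous
`f : C(X, UConf n Y)` is an `n`-valued map from `X` to `Y`. -/
abbrev UConf (n : ℕ) (Y : Type*) : Type _ :=
  Quotient (reorderSetoid n Y)

/-- The underlying `n`-element set of an unordered configuration. -/
def UConf.toSet {n : ℕ} {Y : Type*} : UConf n Y → Set Y :=
  Quotient.lift (fun y => Set.range y.1) (by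
    rintro y z ⟨σ, h⟩
    simp only [h]
    exact (σ.surjective.range_comp y.1).symm)

/-- The fixed point set `Fix(f) = {x | x ∈ f(x)}`. -/
def fixSet {n : ℕ} {X : Type*} (f : X → UConf n X) : Set X :=
  {x | x ∈ (f x).toSet}

end Configurations

/-! ### Lifts to the orbit configuration space -/

section Lifts

variable {X E : Type*} [TopologicalSpace E]

/-- The group of covering transformations of `p : E → X`. When `p` is the universal covering, this
is the group `π = π₁(X)`, acting on `E`. -/
def Deck (p : E → X) : Subgroup (E ≃ₜ E) where
  carrier := {γ | ∀ e, p (γ e) = p e}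
  mul_mem' := by
    intro a b ha hb e
    exact (ha (b e)).trans (hb e)
  one_mem' := fun _ => rfl
  inv_mem' := by
    intro a ha e
    have h := ha (a⁻¹ e)
    have h2 : a (a⁻¹ e) = e := a.apply_symm_apply e
    rw [h2] at h
    exact h.symm

/-- The orbit configuration space `F_n(E, π)`. -/
abbrev OrbitConf (n : ℕ) (p : E → X) : Type _ :=
  {x : Fin n → E // Function.Injective (p ∘ x)}

/-- The map `pⁿ : F_n(E, π) → D_n(X)` applying `p` to each coordinate. -/
def orbitProj (n : ℕ) (p : E → X) (x : OrbitConf n p) : UConf n X :=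
  Quotient.mk (reorderSetoid n X) ⟨p ∘ x.1, x.2⟩

/-- The semidirect product `πⁿ ⋊ Σ_n`, in which
`(α; σ) * (β; ρ) = (k ↦ α k * β (σ⁻¹ k); σ * ρ)`. -/
abbrev Wreath (n : ℕ) (G : Type*) [Group G] : Type _ :=
  SemidirectProduct (Fin n → G) (Equiv.Perm (Fin n)) mulAutArrow

/-- The action of `πⁿ ⋊ Σ_n` on `F_n(E, π)`:
`(α; σ) • (x₁, …, x_n) = (k ↦ α k (x (σ⁻¹ k)))`. -/
def wreathAct {n : ℕ} {p : E → X} (a : Wreath n (Deck p)) (x : OrbitConf n p) : OrbitConf n p :=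
  ⟨fun k => (a.left k : E ≃ₜ E) (x.1 (a.right⁻¹ k)), by
    intro k l h
    have h' : p (x.1 (a.right⁻¹ k)) = p (x.1 (a.right⁻¹ l)) := by
      have h1 := (a.left k).2 (x.1 (a.right⁻¹ k))
      have h2 := (a.left l).2 (x.1 (a.right⁻¹ l))
      exact h1.symm.trans (Eq.trans h h2)
    exact a.right⁻¹.injective (x.2 h')⟩

/-- The map `f̃_# : π → πⁿ ⋊ Σ_n` induced by a lift `f̃ : E → F_n(E, π)`: the element `f̃_#(γ)` is
the unique one such that `f̃ ∘ γ = f̃_#(γ) ∘ f̃`. -/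
noncomputable def inducedMap {n : ℕ} {p : E → X} (F : E → OrbitConf n p) (γ : Deck p) :
    Wreath n (Deck p) :=
  Classical.epsilon fun a => ∀ e : E, F ((γ : E ≃ₜ E) e) = wreathAct a (F e)

end Lifts

/-! ### Reidemeister classes -/

section Reidemeister

variable {n : ℕ} {G : Type*} [Group G]

/-- For `Φ = (φ₁, …, φ_n; σ)`, the relation `(α, k) ∼ (β, j)` iff there is `γ` with `σ_γ(k) = j`
and `α = φ_j(γ)⁻¹ β γ`. -/
def ReidemeisterRel (Φ : G → Wreath n G) (a b : G × Fin n) : Prop :=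
  ∃ γ : G, (Φ γ).right a.2 = b.2 ∧ a.1 = ((Φ γ).left b.2)⁻¹ * b.1 * γ

/-- The set `R(Φ)` of Reidemeister classes. (The relation is an equivalence relation when `Φ` is a
homomorphism.) -/
def ReidemeisterClass (Φ : G → Wreath n G) : Type _ :=
  Quot (ReidemeisterRel Φ)

/-- The class `[(α, k)]`. -/
def ReidemeisterClass.mk (Φ : G → Wreath n G) (α : G) (k : Fin n) : ReidemeisterClass Φ :=
  Quot.mk _ (α, k)

/-- For `Φ = Ψ`, the identification of `ℤ R(Φ)` with `ℤ R(Ψ)` sending `[(α, k)]` to `[(α, k)]`. -/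
noncomputable def reidemeisterIdent {Φ Ψ : G → Wreath n G} (h : Φ = Ψ) :
    (ReidemeisterClass Φ →₀ ℤ) ≃+ (ReidemeisterClass Ψ →₀ ℤ) :=
  Finsupp.domCongr (Quot.congr (Equiv.refl (G × Fin n)) (fun a b => by subst h; rfl))

end Reidemeister

/-! ### Finite polyhedra and a neighbourhood retraction -/

section Polyhedra

variable {V : Type*} [Fintype V]

/-- The geometric realization of a finite simplicial complex in barycentric coordinates. -/
def realization (K : AbstractSimplicialComplex V) : Set (V → ℝ) :=
  {x | (∀ v, 0 ≤ x v) ∧ ∑ v, x v = 1 ∧ ∃ s ∈ K.faces, ∀ v, v ∉ s → x v = 0}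

/-- A triangulation of the space `X` by a finite simplicial complex with vertex set `V`. A finite
polyhedron is a space that has one. -/
structure Triangulation (X : Type*) [TopologicalSpace X] (V : Type*) [Fintype V] where
  complex : AbstractSimplicialComplex V
  homeo : X ≃ₜ realization complex

/-- The levels `c ≥ 0` such that the vertices at which `y` exceeds `c` span a simplex, or
there are none. -/
def goodLevels (K : AbstractSimplicialComplex V) (y : V → ℝ) : Set ℝ :=
  {c | 0 ≤ c ∧ ∀ s : Finset V, s.Nonempty → (∀ v ∈ s, c < y v) → s ∈ K.faces}

/-- The least good level. -/
noncomputable def threshold (K : AbstractSimplicialComplex V) (y : V → ℝ) : ℝ :=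
  sInf (goodLevels K y)

/-- The part of `y` above the least good level. -/
noncomputable def truncation (K : AbstractSimplicialComplex V) (y : V → ℝ) (v : V) : ℝ :=
  max (y v - threshold K y) 0

/-- An open neighbourhood of the realization of `K`, on which the retraction is defined. -/
def retractDomain (K : AbstractSimplicialComplex V) : Set (V → ℝ) :=
  {y | 0 < ∑ v, truncation K y v}

lemma goodLevels_nonempty (K : AbstractSimplicialComplex V) (y : V → ℝ) :
    (goodLevels K y).Nonempty := by
  refine ⟨∑ v, |y v|, Finset.sum_nonneg fun _ _ => abs_nonneg _, ?_⟩
  rintro s ⟨v, hv⟩ h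
  have h1 := h v hv
  have h2 : |y v| ≤ ∑ v, |y v| :=
    Finset.single_le_sum (f := fun v => |y v|) (fun _ _ => abs_nonneg _) (Finset.mem_univ v)
  exact absurd (h1.trans_le (le_abs_self _)) (not_lt.mpr h2)

lemma goodLevels_bddBelow (K : AbstractSimplicialComplex V) (y : V → ℝ) :
    BddBelow (goodLevels K y) :=
  ⟨0, fun _ hc => hc.1⟩

lemma threshold_mem (K : AbstractSimplicialComplex V) (y : V → ℝ) :
    threshold K y ∈ goodLevels K y := by
  refine ⟨le_csInf (goodLevels_nonempty K y) fun _ hc => hc.1, ?_⟩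
  intro s hs h
  obtain ⟨v, hv, hmin⟩ := s.exists_min_image y hs
  obtain ⟨c, hc, hcv⟩ := exists_lt_of_csInf_lt (goodLevels_nonempty K y) (h v hv)
  exact hc.2 s hs fun w hw => hcv.trans_le (hmin w hw)

lemma truncation_nonneg (K : AbstractSimplicialComplex V) (y : V → ℝ) (v : V) :
    0 ≤ truncation K y v :=
  le_max_right _ _

lemma retract_mem (K : AbstractSimplicialComplex V) (y : V → ℝ) (hy : y ∈ retractDomain K) :
    (fun v => truncation K y v / ∑ w, truncation K y w) ∈ realization K := by
  classical
  have hy' : 0 < ∑ w, truncation K y w := hy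
  refine ⟨fun v => div_nonneg (truncation_nonneg K y v) hy'.le, ?_, ?_⟩
  · rw [← Finset.sum_div, div_self hy'.ne']
  · refine ⟨Finset.univ.filter fun v => threshold K y < y v, ?_, ?_⟩
    · refine (threshold_mem K y).2 _ ?_ (by simp)
      by_contra hne
      rw [Finset.not_nonempty_iff_eq_empty, Finset.filter_eq_empty_iff] at hne
      refine hy'.ne' (Finset.sum_eq_zero fun v hv => ?_)
      exact max_eq_right (sub_nonpos.mpr (not_lt.mp (hne hv)))
    · intro v hv
      have h : y v ≤ threshold K y := by simpa using hv
      simp [truncation, sub_nonpos.mpr h]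

/-- The retraction of `retractDomain K` onto the realization of `K`: truncate at the least good
level and normalize. -/
noncomputable def retract (K : AbstractSimplicialComplex V) (y : retractDomain K) :
    realization K :=
  ⟨fun v => truncation K y.1 v / ∑ w, truncation K y.1 w, retract_mem K y.1 y.2⟩

lemma threshold_eq_zero (K : AbstractSimplicialComplex V) {x : V → ℝ} (hx : x ∈ realization K) :
    threshold K x = 0 := by
  obtain ⟨-, -, s, hs, h0⟩ := hx
  refine le_antisymm (csInf_le (goodLevels_bddBelow K x) ⟨le_rfl, fun t ht hpos => ?_⟩)
    (threshold_mem K x).1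
  refine (K.isRelLowerSet_faces hs).2 (fun v hv => ?_) ht
  by_contra hvs
  exact (hpos v hv).ne' (h0 v hvs)

lemma truncation_eq_self (K : AbstractSimplicialComplex V) {x : V → ℝ}
    (hx : x ∈ realization K) : truncation K x = x := by
  funext v
  simp [truncation, threshold_eq_zero K hx, hx.1 v]

lemma realization_subset_retractDomain (K : AbstractSimplicialComplex V) :
    realization K ⊆ retractDomain K := by
  intro x hx
  simp only [retractDomain, Set.mem_ofPred_eq, truncation_eq_self K hx, hx.2.1, zero_lt_one]

lemma retract_eq_self (K : AbstractSimplicialComplex V) (x : realization K) :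
    retract K ⟨x.1, realization_subset_retractDomain K x.2⟩ = x := by
  apply Subtype.ext
  funext v
  simp [retract, truncation_eq_self K x.2, x.2.2.1]

lemma continuous_threshold (K : AbstractSimplicialComplex V) : Continuous (threshold K) := by
  have key : ∀ y z : V → ℝ, threshold K y ≤ threshold K z + dist y z := by
    intro y z
    refine csInf_le (goodLevels_bddBelow K y)
      ⟨add_nonneg (threshold_mem K z).1 dist_nonneg, fun s hs h => ?_⟩
    refine (threshold_mem K z).2 s hs fun v hv => ?_
    have h1 := h v hv
    have h2 : y v - z v ≤ dist y z :=
      (le_abs_self _).trans ((Real.dist_eq _ _).symm.le.trans (dist_le_pi_dist y z v))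
    linarith
  exact (LipschitzWith.of_le_add key).continuous

lemma continuous_truncation (K : AbstractSimplicialComplex V) (v : V) :
    Continuous fun y => truncation K y v :=
  ((continuous_apply v).sub (continuous_threshold K)).max continuous_const

lemma isOpen_retractDomain (K : AbstractSimplicialComplex V) : IsOpen (retractDomain K) :=
  isOpen_lt continuous_const (continuous_finsetSum _ fun v _ => continuous_truncation K v)

lemma continuous_retract (K : AbstractSimplicialComplex V) : Continuous (retract K) := by
  refine Continuous.subtype_mk (continuous_pi fun v => ?_) _
  refine Continuous.div ((continuous_truncation K v).comp continuous_subtype_val) ?_ ?_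
  · exact (continuous_finsetSum _ fun w _ => continuous_truncation K w).comp
      continuous_subtype_val
  · intro y
    exact ne_of_gt y.2

end Polyhedra

/-! ### The fixed point index -/

section Index

variable {V : Type*} [Fintype V]

/-- `d` is the Brouwer degree over `0` of `ψ` on the open set `Ω`, where `Ω ∩ ψ⁻¹(0)` is compact
and `ψ` is continuous near this set: on a small enough neighbourhood `N` of `Ω ∩ ψ⁻¹(0)`, every
smooth map `φ` sufficiently close to `ψ` for which `0` is a regular value has exactly `d` zeros,
counted with the signs of the Jacobian determinants. -/
def IsBrouwerDegree (ψ : (V → ℝ) → (V → ℝ)) (Ω : Set (V → ℝ)) (d : ℤ) : Prop :=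
  ∃ N : Set (V → ℝ), IsOpen N ∧ IsCompact (closure N) ∧ closure N ⊆ Ω ∧
    Ω ∩ ψ ⁻¹' {0} ⊆ N ∧ ContinuousOn ψ (closure N) ∧
    ∃ ε : ℝ, 0 < ε ∧ ∀ φ : (V → ℝ) → (V → ℝ), ContDiff ℝ ∞ φ →
      (∀ x ∈ closure N, ‖φ x - ψ x‖ < ε) →
      (∀ x ∈ N, φ x = 0 → (fderiv ℝ φ x).det ≠ 0) →
      (N ∩ φ ⁻¹' {0}).Finite ∧
        ∑ᶠ x ∈ N ∩ φ ⁻¹' {0}, (SignType.sign (fderiv ℝ φ x).det : ℤ) = d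

variable {X : Type*} [TopologicalSpace X]

/-- The open set `r⁻¹(W)` in the space of barycentric coordinates, for `W ⊆ X`, where
`r` is the neighbourhood retraction onto the triangulated space `X`. -/
def thicken (T : Triangulation X V) (W : Set X) : Set (V → ℝ) :=
  {y | ∃ h : y ∈ retractDomain T.complex, T.homeo.symm (retract T.complex ⟨y, h⟩) ∈ W}

open Classical in
/-- The map `id - s ∘ r` in the space of barycentric coordinates, for `s : X → X`, where
`r` is the neighbourhood retraction onto the triangulated space `X`. (Only its values on the
domain of `r` matter.) -/
noncomputable def displacement (T : Triangulation X V) (s : X → X) (y : V → ℝ) : V → ℝ :=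
  if h : y ∈ retractDomain T.complex then
    y - (T.homeo (s (T.homeo.symm (retract T.complex ⟨y, h⟩)))).1
  else 0

/-- `s` is a single-valued continuous selection of the `n`-valued map `f` on an open set `W`,
with `Fix(f) ∩ U ⊆ W ⊆ U`, that splits off the branch of `f` with all the fixed points in `U`. -/
structure IsFixedBranch {n : ℕ} (f : X → UConf n X) (U W : Set X) (s : X → X) : Prop where
  isOpen : IsOpen W
  subset : W ⊆ U
  fixSet_subset : fixSet f ∩ U ⊆ W
  continuousOn : ContinuousOn s W
  mem : ∀ x ∈ W, s x ∈ (f x).toSet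
  fixed : ∀ x ∈ fixSet f ∩ U, s x = x

/-- `d` is the fixed point index of the `n`-valued map `f` on `U`: the classical fixed point index
of the single-valued branch of `f` through the fixed points in `U`, that is, the degree
of `id - s ∘ r` over `0`. -/
def IsFixedPointIndex (T : Triangulation X V) {n : ℕ} (f : X → UConf n X) (U : Set X) (d : ℤ) :
    Prop :=
  ∃ (W : Set X) (s : X → X), IsFixedBranch f U W s ∧
    IsBrouwerDegree (displacement T s) (thicken T W) d

open Classical in
/-- The fixed point index `ind(f, U)`, for an open set `U` with `Fix(f) ∩ U` compact. -/
noncomputable def index (T : Triangulation X V) {n : ℕ} (f : X → UConf n X) (U : Set X) : ℤ :=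
  if h : ∃ d, IsFixedPointIndex T f U d then h.choose else 0

end Index

/-! ### The Reidemeister trace -/

section Trace

variable {X E : Type*} [TopologicalSpace X] [TopologicalSpace E] {n : ℕ} {p : E → X}

/-- The set `p Fix(α⁻¹ f̃_k)`. -/
def pFix (F : E → OrbitConf n p) (α : Deck p) (k : Fin n) : Set X :=
  p '' {e | ((α⁻¹ : Deck p) : E ≃ₜ E) ((F e).1 k) = e}

/-- The fixed point class belonging to a Reidemeister class: the set `p Fix(α⁻¹ f̃_k)`, which is the
same for all representatives `(α, k)`. -/
def fixClass (F : E → OrbitConf n p) (c : ReidemeisterClass (inducedMap F)) : Set X :=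
  {x | ∃ α k, ReidemeisterClass.mk (inducedMap F) α k = c ∧ x ∈ pFix F α k}

/-- The largest open set that contains the given fixed point class of `f` and no other fixed point
of `f`. -/
def classNhd (f : X → UConf n X) (F : E → OrbitConf n p)
    (c : ReidemeisterClass (inducedMap F)) : Set X :=
  (fixSet f \ fixClass F c)ᶜ

/-- The Reidemeister trace
`RT(f, f̃) = ∑ ind(f, U_{[(α, k)]}) [(α, k)]`, an element of `ℤ R(f̃_#)`. -/
noncomputable def reidemeisterTrace {V : Type*} [Fintype V] (T : Triangulation X V)
    (f : X → UConf n X) (F : E → OrbitConf n p) : ReidemeisterClass (inducedMap F) →₀ ℤ :=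
  ∑ᶠ c : ReidemeisterClass (inducedMap F), Finsupp.single c (index T f (classNhd f F c))

end Trace

end NValued

/-!
The theorem splits into a statement about covering spaces and one about the fixed point index.

*Coverings.* The map `orbitProj` from the orbit configuration space is separated and locally
injective, so two lifts through it that agree at a point of a connected space are equal
(`eq_of_orbitProj_comp_eq`). Applied to `t ↦ L_t (γ e)` and `t ↦ a • L_t e`, this shows that an
element `a` of the wreath product that serves for `γ` at one stage `t` of the homotopy serves at
every stage, whence `inducedMap_eq_of_homotopy`. Since the covering transformations act simply
transitively on the fibres, every fixed point lies in exactly one fixed point class. Following a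
lift locally, all fixed points near a given one, at nearby stages, are in its class
(`eventually_mem_fixClassOf`). So the total space of a class is open and closed in the closed set
`{(t, x) | x ∈ H_t x}`.

*Index.* The point of the configuration `H_t x` that is nearest to `x` depends continuously on
`(t, x)` where it is unique, in particular near all fixed points (`exists_nearest_selection`).
This gives a single-valued branch for all stages at once. Any two branches through the same fixed
points agree near them, so the index does not depend on the branch (`IsFixedPointIndex.unique`).
The zeros of the displacement maps of the branch form a compact set, a copy of the total space of
the class, so the degree of the displacement is locally constant in `t`
(`IsBrouwerDegree.eventually`), hence constant.

*Degree.* All of this needs the Brouwer degree to exist and to be unique. Sard's theorem provides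
smooth approximations with regular value `0`. That two of them have the same signed count of zeros
is shown with the integral of `h(φ(x)) det Dφ(x)`, for a bump function `h` concentrated at `0`. By
the change of variables formula the integral is a multiple of the signed count
(`exists_integral_eq_signedCount`); along a straight-line homotopy its derivative is the integral
of the divergence of a compactly supported vector field, by the Piola identity
(`sum_fderiv_detRows_update`), and so vanishes (`integral_comp_mul_det_eq`).
-/

namespace NValued

open Set Filter Topology MeasureTheory

/-! ### Derivatives of determinants -/

section DeterminantCalculus

variable {V : Type*} [Fintype V] [DecidableEq V]

/-- The determinant as a continuous multilinear function of the rows. -/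
noncomputable def detRows (V : Type*) [Fintype V] [DecidableEq V] :
    ContinuousMultilinearMap ℝ (fun _ : V => V → ℝ) ℝ where
  toMultilinearMap := (Matrix.detRowAlternating (n := V) (R := ℝ)).toMultilinearMap
  cont := Continuous.matrix_det (A := fun M : V → V → ℝ => Matrix.of M) continuous_id

lemma detRows_apply (M : V → V → ℝ) : detRows V M = (Matrix.of M).det := rfl

/-- The partial derivatives of `φ`, that is, the columns of the Jacobian matrix. -/
noncomputable def partials (φ : (V → ℝ) → (V → ℝ)) (x : V → ℝ) (j : V) : V → ℝ :=
  fderiv ℝ φ x (Pi.single j 1)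

lemma det_fderiv_eq_detRows (φ : (V → ℝ) → (V → ℝ)) (x : V → ℝ) :
    (fderiv ℝ φ x).det = detRows V (partials φ x) := by
  rw [detRows_apply, ← Matrix.det_transpose, ContinuousLinearMap.det, ← LinearMap.det_toMatrix']
  rfl

lemma detRows_update_swap (M : V → V → ℝ) {j l : V} (h : j ≠ l) (u w : V → ℝ) :
    detRows V (Function.update (Function.update M j u) l w) =
      - detRows V (Function.update (Function.update M l u) j w) := by
  have := (Matrix.detRowAlternating (n := V) (R := ℝ)).map_swap
    (Function.update (Function.update M l u) j w) h
  change detRows V _ = - detRows V _ at this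
  rw [← this]
  congr 1
  ext a b
  by_cases ha : a = j
  · subst ha; simp [Function.update_of_ne h, Function.update_of_ne h.symm]
  · by_cases hb : a = l
    · subst hb; simp
    · simp [Function.update, ha, hb, Equiv.swap_apply_of_ne_of_ne ha hb]

/-- Cramer's rule. -/
lemma sum_apply_mul_detRows_update (M : V → V → ℝ) (u : V → ℝ) (l : (V → ℝ) →L[ℝ] ℝ) :
    ∑ j, l (M j) * detRows V (Function.update M j u) = l u * detRows V M := by
  have h := Matrix.mulVec_cramer (Matrix.of M).transpose u
  have h2 := congrArg l h
  rw [map_smul, Matrix.det_transpose, smul_eq_mul, mul_comm] at h2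
  rw [detRows_apply, ← h2]
  have : (Matrix.of M).transpose.mulVec ((Matrix.of M).transpose.cramer u) =
      ∑ j, ((Matrix.of M).transpose.cramer u j) • M j := by
    ext i
    simp [Matrix.mulVec, dotProduct, Finset.sum_apply, mul_comm]
  rw [this, map_sum]
  refine Finset.sum_congr rfl fun j _ => ?_
  rw [map_smul, smul_eq_mul, mul_comm, Matrix.cramer_transpose_apply]
  rfl

lemma contDiff_partials {φ : (V → ℝ) → (V → ℝ)} (hφ : ContDiff ℝ ∞ φ) :
    ContDiff ℝ ∞ (partials φ) := by
  refine contDiff_pi.2 fun j => ?_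
  exact (hφ.fderiv_right (m := ∞) (by simp)).clm_apply contDiff_const

lemma fderiv_partials {φ : (V → ℝ) → (V → ℝ)} (hφ : ContDiff ℝ ∞ φ) (x : V → ℝ) (i j : V) :
    fderiv ℝ (partials φ) x (Pi.single j 1) i =
      fderiv ℝ (partials φ) x (Pi.single i 1) j := by
  have h1 : ∀ i j, fderiv ℝ (partials φ) x (Pi.single j 1) i =
      fderiv ℝ (fderiv ℝ φ) x (Pi.single j 1) (Pi.single i 1) := by
    intro i j
    have hd : DifferentiableAt ℝ (fderiv ℝ φ) x :=
      ((hφ.fderiv_right (m := ∞) (by simp)).differentiable (by simp)).differentiableAt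
    have : HasFDerivAt (partials φ) (ContinuousLinearMap.pi fun i =>
        (fderiv ℝ (fderiv ℝ φ) x).flip (Pi.single i 1)) x := by
      refine hasFDerivAt_pi.2 fun i => ?_
      have := hd.hasFDerivAt.clm_apply (hasFDerivAt_const (Pi.single i (1:ℝ) : V → ℝ) x)
      refine this.congr_fderiv ?_
      ext y; simp
    rw [this.fderiv]; simp
  rw [h1, h1]
  exact (hφ.contDiffAt.isSymmSndFDerivAt (by simpa using ENat.LEInfty.out)).eq _ _

lemma contDiff_update_partials {φ η : (V → ℝ) → (V → ℝ)} (hφ : ContDiff ℝ ∞ φ)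
    (hη : ContDiff ℝ ∞ η) (j : V) :
    ContDiff ℝ ∞ fun x => Function.update (partials φ x) j (η x) := by
  refine contDiff_pi.2 fun l => ?_
  by_cases h : l = j
  · subst h; simpa using hη
  · simpa [Function.update, h] using contDiff_pi.1 (contDiff_partials hφ) l

lemma hasFDerivAt_detRows_comp {E : Type*} [NormedAddCommGroup E] [NormedSpace ℝ E]
    {c : E → V → V → ℝ} {x : E} (hc : DifferentiableAt ℝ c x) :
    HasFDerivAt (fun x => detRows V (c x))
      (((detRows V).linearDeriv (c x)).comp (fderiv ℝ c x)) x :=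
  ((detRows V).hasFDerivAt (c x)).comp x hc.hasFDerivAt

/-- The divergence of the vector field whose `j`-th component is the Jacobian determinant of `φ` with
the `j`-th column replaced by `η`. The second derivatives of `φ` cancel; this is the Piola
identity. -/
lemma sum_fderiv_detRows_update {φ η : (V → ℝ) → (V → ℝ)} (hφ : ContDiff ℝ ∞ φ)
    (hη : ContDiff ℝ ∞ η) (x : V → ℝ) :
    ∑ j, fderiv ℝ (fun x => detRows V (Function.update (partials φ x) j (η x))) x (Pi.single j 1) =
      ∑ j, detRows V (Function.update (partials φ x) j (partials η x j)) := by
  have hdφ : DifferentiableAt ℝ (partials φ) x :=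
    ((contDiff_partials hφ).differentiable (by simp)).differentiableAt
  have hdη : DifferentiableAt ℝ η x := (hη.differentiable (by simp)).differentiableAt
  have key : ∀ j, fderiv ℝ (fun x => detRows V (Function.update (partials φ x) j (η x))) x
      (Pi.single j 1) = detRows V (Function.update (partials φ x) j (partials η x j)) +
      ∑ l ∈ Finset.univ.erase j, detRows V (Function.update
        (Function.update (partials φ x) j (η x)) l
        (fderiv ℝ (partials φ) x (Pi.single j 1) l)) := by
    intro j
    have hc : HasFDerivAt (fun x => Function.update (partials φ x) j (η x))
        (ContinuousLinearMap.pi fun l => if l = j then fderiv ℝ η x else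
          (ContinuousLinearMap.proj l).comp (fderiv ℝ (partials φ) x)) x := by
      refine hasFDerivAt_pi.2 fun l => ?_
      by_cases h : l = j
      · subst h
        simpa using hdη.hasFDerivAt
      · simpa [Function.update, h] using hasFDerivAt_pi'.1 hdφ.hasFDerivAt l
    rw [(hasFDerivAt_detRows_comp hc.differentiableAt).fderiv, hc.fderiv,
      ContinuousLinearMap.comp_apply, ContinuousMultilinearMap.linearDeriv_apply]
    rw [← Finset.add_sum_erase _ _ (Finset.mem_univ j)]
    congr 1
    · simp [partials]
    · refine Finset.sum_congr rfl fun l hl => ?_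
      simp [Finset.ne_of_mem_erase hl]
  simp only [key, Finset.sum_add_distrib]
  -- The terms with second derivatives cancel in pairs: the entry is antisymmetric in `(j, l)`.
  set A : V → V → ℝ := fun j l => detRows V (Function.update
    (Function.update (partials φ x) j (η x)) l (fderiv ℝ (partials φ) x (Pi.single j 1) l)) with hA
  have hanti : ∀ j l, l ≠ j → A j l = - A l j := by
    intro j l h
    simp only [hA]
    rw [detRows_update_swap _ h.symm, fderiv_partials hφ]
  have hS : ∑ j, ∑ l ∈ Finset.univ.erase j, A j l = - ∑ j, ∑ l ∈ Finset.univ.erase j, A j l := by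
    conv_rhs => rw [Finset.sum_comm' (t' := Finset.univ) (s' := fun l => Finset.univ.erase l)
      (by simp [eq_comm])]
    simp only [← Finset.sum_neg_distrib]
    refine Finset.sum_congr rfl fun j _ => Finset.sum_congr rfl fun l hl => ?_
    exact hanti j l (Finset.ne_of_mem_erase hl)
  linarith

end DeterminantCalculus

/-! ### The degree integral -/

section DegreeIntegral

lemma hasDerivAt_integral_of_support_subset {E : Type*} [NormedAddCommGroup E] [MeasurableSpace E]
    [BorelSpace E] (μ : Measure E) [IsFiniteMeasureOnCompacts μ] {G G' : ℝ → E → ℝ}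
    (hG : Continuous (Function.uncurry G)) (hG' : Continuous (Function.uncurry G'))
    (hd : ∀ t x, HasDerivAt (fun t => G t x) (G' t x) t) {K : Set E} (hK : IsCompact K)
    (hGK : ∀ t, ∀ x ∉ K, G t x = 0) (hGK' : ∀ t, ∀ x ∉ K, G' t x = 0) (t : ℝ) :
    HasDerivAt (fun t => ∫ x, G t x ∂μ) (∫ x, G' t x ∂μ) t := by
  have hcG : ∀ t, Continuous (G t) := fun t => hG.comp (by fun_prop : Continuous fun x => (t, x))
  have hcG' : ∀ t, Continuous (G' t) := fun t => hG'.comp (by fun_prop : Continuous fun x => (t, x))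
  have hint : ∀ t, Integrable (G t) μ := fun t =>
    (hcG t).integrable_of_hasCompactSupport (HasCompactSupport.intro hK (hGK t))
  obtain ⟨C, hC⟩ := ((isCompact_closedBall t 1).prod hK).exists_bound_of_continuousOn
    hG'.continuousOn
  refine (hasDerivAt_integral_of_dominated_loc_of_deriv_le (F' := G')
    (bound := K.indicator fun _ => C)
    (Metric.closedBall_mem_nhds t one_pos) (Eventually.of_forall fun t => (hint t).1)
    (hint t) ((hcG' t).integrable_of_hasCompactSupport (HasCompactSupport.intro hK (hGK' t))).1
    (Eventually.of_forall fun x s hs => ?_) ?_ (Eventually.of_forall fun x s _ => hd s x)).2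
  · by_cases hx : x ∈ K
    · rw [indicator_of_mem hx]
      exact hC (s, x) ⟨hs, hx⟩
    · rw [indicator_of_notMem hx, hGK' s x hx, norm_zero]
  · rw [integrable_indicator_iff hK.isClosed.measurableSet]
    exact integrableOn_const hK.measure_lt_top.ne

variable {V : Type*} [Fintype V] [DecidableEq V]

/-- The divergence theorem for a compactly supported vector field. -/
lemma integral_sum_fderiv_eq_zero {v : V → (V → ℝ) → ℝ} (hv : ∀ j, ContDiff ℝ ∞ (v j))
    (hc : ∀ j, HasCompactSupport (v j)) :
    ∫ x, ∑ j, fderiv ℝ (v j) x (Pi.single j 1) = 0 := by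
  have hi : ∀ j, Integrable fun x => fderiv ℝ (v j) x (Pi.single j 1) := fun j =>
    Continuous.integrable_of_hasCompactSupport
      (((hv j).continuous_fderiv (by simp)).clm_apply continuous_const)
      ((hc j).fderiv_apply ℝ _)
  rw [integral_finsetSum _ fun j _ => hi j]
  refine Finset.sum_eq_zero fun j _ => ?_
  have := integral_mul_fderiv_eq_neg_fderiv_mul_of_integrable (μ := volume)
    (f := fun _ : V → ℝ => (1 : ℝ)) (g := v j) (v := Pi.single j 1) (by simp)
    (by simpa using hi j)
    (by simpa using (hv j).continuous.integrable_of_hasCompactSupport (hc j))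
    (fun x _ => differentiableAt_const _)
    (fun x _ => ((hv j).differentiable (by simp)).differentiableAt)
  simpa using this

/-- Where `h ∘ φ` or the derivative of the cutoff `χ` vanishes, the first variation of
`χ (h ∘ φ) det Dφ` in the direction `η` is a divergence. -/
lemma variation_eq_divergence {φ η : (V → ℝ) → (V → ℝ)} {h χ : (V → ℝ) → ℝ}
    (hφ : ContDiff ℝ ∞ φ) (hη : ContDiff ℝ ∞ η) (hh : ContDiff ℝ ∞ h) (hχ : ContDiff ℝ ∞ χ)
    (x : V → ℝ) (h0 : h (φ x) • fderiv ℝ χ x = 0) :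
    χ x * (fderiv ℝ h (φ x) (η x) * detRows V (partials φ x) +
      h (φ x) * ∑ j, detRows V (Function.update (partials φ x) j (partials η x j))) =
    ∑ j, fderiv ℝ (fun x => χ x * h (φ x) * detRows V (Function.update (partials φ x) j (η x))) x
      (Pi.single j 1) := by
  have hdφ := ((hφ.differentiable (by simp)) x).hasFDerivAt
  have hdh := ((hh.differentiable (by simp)) (φ x)).hasFDerivAt
  have hdχ := ((hχ.differentiable (by simp)) x).hasFDerivAt
  have hdet : ∀ j, DifferentiableAt ℝ
      (fun x => detRows V (Function.update (partials φ x) j (η x))) x := by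
    intro j
    exact (hasFDerivAt_detRows_comp
      ((contDiff_update_partials hφ hη j).differentiable (by simp) x)).differentiableAt
  have key : ∀ j, fderiv ℝ (fun x => χ x * h (φ x) *
      detRows V (Function.update (partials φ x) j (η x))) x (Pi.single j 1) =
      χ x * (fderiv ℝ h (φ x) (partials φ x j) *
          detRows V (Function.update (partials φ x) j (η x))) +
        χ x * h (φ x) * fderiv ℝ (fun x => detRows V (Function.update (partials φ x) j (η x))) x
          (Pi.single j 1) := by
    intro j
    have hd : HasFDerivAt (fun x => χ x * h (φ x) *
        detRows V (Function.update (partials φ x) j (η x))) _ x :=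
      (hdχ.mul (hdh.comp x hdφ)).mul (hdet j).hasFDerivAt
    have h0' : h (φ x) * fderiv ℝ χ x (Pi.single j 1) = 0 := by
      simpa using congrArg (fun l => l (Pi.single j 1)) h0
    rw [hd.fderiv]
    simp only [Function.comp_apply, Pi.mul_apply, _root_.add_apply, _root_.smul_apply,
      ContinuousLinearMap.comp_apply, smul_eq_mul, partials, h0']
    ring
  simp only [key, Finset.sum_add_distrib, ← Finset.mul_sum]
  rw [sum_fderiv_detRows_update hφ hη, sum_apply_mul_detRows_update]
  ring

/-- Homotopy invariance of the degree integral along a straight-line homotopy. -/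
theorem integral_comp_mul_det_eq {φ₀ φ₁ : (V → ℝ) → (V → ℝ)} {h χ : (V → ℝ) → ℝ}
    (hφ₀ : ContDiff ℝ ∞ φ₀) (hφ₁ : ContDiff ℝ ∞ φ₁) (hh : ContDiff ℝ ∞ h) (hχ : ContDiff ℝ ∞ χ)
    (hχc : HasCompactSupport χ)
    (h0 : ∀ t ∈ Icc (0 : ℝ) 1, ∀ x, h (φ₀ x + t • (φ₁ x - φ₀ x)) • fderiv ℝ χ x = 0) :
    ∫ x, χ x * h (φ₀ x) * (fderiv ℝ φ₀ x).det = ∫ x, χ x * h (φ₁ x) * (fderiv ℝ φ₁ x).det := by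
  set η : (V → ℝ) → (V → ℝ) := fun x => φ₁ x - φ₀ x with hηdef
  have hη : ContDiff ℝ ∞ η := hφ₁.sub hφ₀
  set ψ : ℝ → (V → ℝ) → (V → ℝ) := fun t x => φ₀ x + t • η x with hψdef
  have hψ : ∀ t, ContDiff ℝ ∞ (ψ t) := fun t => hφ₀.add (hη.const_smul t)
  have hpart : ∀ t x, partials (ψ t) x = partials φ₀ x + t • partials η x := by
    intro t x
    have h1 := ((hφ₀.differentiable (by simp)) x).hasFDerivAt
    have h2 := ((hη.differentiable (by simp)) x).hasFDerivAt
    have h3 : HasFDerivAt (ψ t) _ x := h1.add (h2.const_smul t)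
    funext j
    simp [partials, h3.fderiv]
  have hcφ := (contDiff_partials hφ₀).continuous
  have hcη := (contDiff_partials hη).continuous
  have hcψ : Continuous (Function.uncurry ψ) := by
    have := hφ₀.continuous; have := hη.continuous
    simp only [Function.uncurry_def, hψdef]; fun_prop
  -- `G t` is the integrand at the stage `t` of the homotopy, and `G' t` its derivative in `t`.
  set G : ℝ → (V → ℝ) → ℝ := fun t x => χ x * h (ψ t x) * detRows V (partials (ψ t) x) with hG
  set G' : ℝ → (V → ℝ) → ℝ := fun t x => χ x * (fderiv ℝ h (ψ t x) (η x) *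
    detRows V (partials (ψ t) x) + h (ψ t x) *
      ∑ j, detRows V (Function.update (partials (ψ t) x) j (partials η x j))) with hG'
  have hcpart : Continuous fun q : ℝ × (V → ℝ) => partials (ψ q.1) q.2 := by
    simp only [hpart]; fun_prop
  have hcont : Continuous (Function.uncurry G) := by
    have h1 := (detRows V).cont.comp hcpart
    have h2 := hh.continuous.comp hcψ
    exact ((hχ.continuous.comp continuous_snd).mul h2).mul h1
  have hcont' : Continuous (Function.uncurry G') := by
    have h1 := (detRows V).cont.comp hcpart
    have h2 := hh.continuous.comp hcψ
    have h3 : Continuous fun q : ℝ × (V → ℝ) => fderiv ℝ h (ψ q.1 q.2) (η q.2) :=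
      ((hh.continuous_fderiv (by simp)).comp hcψ).clm_apply (hη.continuous.comp continuous_snd)
    have h4 : Continuous fun q : ℝ × (V → ℝ) => ∑ j, detRows V
        (Function.update (partials (ψ q.1) q.2) j (partials η q.2 j)) := by
      refine continuous_finsetSum _ fun j _ => (detRows V).cont.comp (hcpart.update j ?_)
      exact (continuous_apply j).comp (hcη.comp continuous_snd)
    exact (hχ.continuous.comp continuous_snd).mul ((h3.mul h1).add (h2.mul h4))
  have hderiv : ∀ t x, HasDerivAt (fun t => G t x) (G' t x) t := by
    intro t x
    have h1 : HasDerivAt (fun t => ψ t x) (η x) t := by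
      have := ((hasDerivAt_id t).smul_const (η x)).const_add (φ₀ x)
      rwa [one_smul] at this
    have h2 : HasDerivAt (fun t => partials (ψ t) x) (partials η x) t := by
      simp only [hpart]
      simpa using ((hasDerivAt_id t).smul_const (partials η x)).const_add (partials φ₀ x)
    have h3 := ((hh.differentiable (by simp)) (ψ t x)).hasFDerivAt.comp_hasDerivAt t h1
    have h4 := ((detRows V).hasFDerivAt (partials (ψ t) x)).comp_hasDerivAt t h2
    have := (h3.const_mul (χ x)).mul h4
    refine this.congr_deriv ?_
    rw [ContinuousMultilinearMap.linearDeriv_apply]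
    simp only [hG', Function.comp_apply]
    ring
  have hder0 : ∀ t ∈ Icc (0 : ℝ) 1, ∫ x, G' t x = 0 := by
    intro t ht
    rw [integral_congr_ae (Eventually.of_forall fun x =>
      variation_eq_divergence (hψ t) hη hh hχ x (h0 t ht x))]
    refine integral_sum_fderiv_eq_zero (fun j => ?_) fun j => ?_
    · refine (hχ.mul (hh.comp (hψ t))).mul ((detRows V).contDiff.comp ?_)
      exact contDiff_update_partials (hψ t) hη j
    · simp only [mul_assoc]
      exact hχc.mul_right
  have hz : ∀ x ∉ tsupport χ, χ x = 0 := fun x hx => image_eq_zero_of_notMem_tsupport hx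
  have hD : ∀ t, HasDerivAt (fun t => ∫ x, G t x) (∫ x, G' t x) t :=
    hasDerivAt_integral_of_support_subset volume hcont hcont' hderiv hχc
      (fun t x hx => by simp [hG, hz x hx]) (fun t x hx => by simp [hG', hz x hx])
  have hfin := constant_of_has_deriv_right_zero (f := fun t => ∫ x, G t x) (a := 0) (b := 1)
    (fun t _ => (hD t).continuousAt.continuousWithinAt)
    (fun t ht => by
      have := (hD t).hasDerivWithinAt (s := Ici t)
      rwa [hder0 t ⟨ht.1, ht.2.le⟩] at this) 1 (by simp)
  have hψ0 : ψ 0 = φ₀ := by funext x; simp [hψdef]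
  have hψ1 : ψ 1 = φ₁ := by funext x; simp [hψdef, hηdef]
  simp only [hG, hψ0, hψ1] at hfin
  simp only [det_fderiv_eq_detRows]
  exact hfin.symm

end DegreeIntegral

/-! ### Signed counts of zeros -/

section LocalDegree

variable {V : Type*} [Fintype V]

lemma hasStrictFDerivAt_equiv_of_det_ne_zero {φ : (V → ℝ) → (V → ℝ)} (hφ : ContDiff ℝ ∞ φ)
    {z : V → ℝ} (hz : (fderiv ℝ φ z).det ≠ 0) :
    HasStrictFDerivAt φ (((fderiv ℝ φ z).toContinuousLinearEquivOfDetNeZero hz :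
      (V → ℝ) ≃L[ℝ] (V → ℝ)) : (V → ℝ) →L[ℝ] (V → ℝ)) z := by
  have := hφ.contDiffAt.hasStrictFDerivAt (x := z) (by simp)
  exact this

/-- The inverse function theorem at a regular point. -/
lemma exists_injOn_of_det_ne_zero {φ : (V → ℝ) → (V → ℝ)} (hφ : ContDiff ℝ ∞ φ) {z : V → ℝ}
    (hz : (fderiv ℝ φ z).det ≠ 0) {O : Set (V → ℝ)} (hO : O ∈ 𝓝 z) :
    ∃ W, IsOpen W ∧ z ∈ W ∧ W ⊆ O ∧ InjOn φ W ∧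
      ∀ x ∈ W, SignType.sign (fderiv ℝ φ x).det = SignType.sign (fderiv ℝ φ z).det := by
  have hstrict := hasStrictFDerivAt_equiv_of_det_ne_zero hφ hz
  set e := hstrict.toOpenPartialHomeomorph φ
  have hcont : Continuous fun x => (fderiv ℝ φ x).det :=
    ContinuousLinearMap.continuous_det.comp (hφ.continuous_fderiv (by simp))
  have hsign : ∀ᶠ x in 𝓝 z,
      SignType.sign (fderiv ℝ φ x).det = SignType.sign (fderiv ℝ φ z).det := by
    rcases lt_or_gt_of_ne hz with h | h
    · filter_upwards [hcont.continuousAt.eventually_lt continuousAt_const h] with x hx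
      rw [sign_neg hx, sign_neg h]
    · filter_upwards [continuousAt_const.eventually_lt hcont.continuousAt h] with x hx
      rw [sign_pos hx, sign_pos h]
  have hmem : e.source ∩ (O ∩ {x | SignType.sign (fderiv ℝ φ x).det =
      SignType.sign (fderiv ℝ φ z).det}) ∈ 𝓝 z :=
    inter_mem (e.open_source.mem_nhds hstrict.mem_toOpenPartialHomeomorph_source)
      (inter_mem hO hsign)
  obtain ⟨W, hW, hWo, hzW⟩ := mem_nhds_iff.1 hmem
  exact ⟨W, hWo, hzW, fun x hx => (hW hx).2.1, e.injOn.mono fun x hx => (hW hx).1,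
    fun x hx => (hW hx).2.2⟩

lemma image_mem_nhds_of_det_ne_zero {φ : (V → ℝ) → (V → ℝ)} (hφ : ContDiff ℝ ∞ φ) {z : V → ℝ}
    (hz : (fderiv ℝ φ z).det ≠ 0) {O : Set (V → ℝ)} (hO : O ∈ 𝓝 z) : φ '' O ∈ 𝓝 (φ z) := by
  have hstrict := hasStrictFDerivAt_equiv_of_det_ne_zero hφ hz
  rw [← hstrict.map_nhds_eq_of_equiv]
  exact image_mem_map hO

/-- The zeros of `φ` in `N` counted with the signs of the Jacobian determinants. -/
noncomputable def signedCount (φ : (V → ℝ) → (V → ℝ)) (N : Set (V → ℝ)) : ℤ :=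
  ∑ᶠ x ∈ N ∩ φ ⁻¹' {0}, (SignType.sign (fderiv ℝ φ x).det : ℤ)

lemma finite_zeros_of_regular {φ : (V → ℝ) → (V → ℝ)} (hφ : ContDiff ℝ ∞ φ) {N : Set (V → ℝ)}
    (hNo : IsOpen N) (hN : IsCompact (closure N)) (hfr : ∀ x ∈ frontier N, φ x ≠ 0)
    (hreg : ∀ x ∈ N, φ x = 0 → (fderiv ℝ φ x).det ≠ 0) : (N ∩ φ ⁻¹' {0}).Finite := by
  have hZ : N ∩ φ ⁻¹' {0} = closure N ∩ φ ⁻¹' {0} := by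
    refine Subset.antisymm (inter_subset_inter_left _ subset_closure) fun x hx => ⟨?_, hx.2⟩
    by_contra hxN
    exact hfr x ⟨hx.1, by rwa [hNo.interior_eq]⟩ hx.2
  have hcomp : IsCompact (N ∩ φ ⁻¹' {0}) := by
    rw [hZ]; exact hN.inter_right (isClosed_singleton.preimage hφ.continuous)
  have hloc : ∀ z ∈ N ∩ φ ⁻¹' {0}, ∃ U ∈ 𝓝 z, InjOn φ U := fun z hz =>
    let ⟨W, hW, hzW, _, hinj, _⟩ := exists_injOn_of_det_ne_zero hφ (hreg z hz.1 hz.2) univ_mem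
    ⟨W, hW.mem_nhds hzW, hinj⟩
  choose! U hU hinj using hloc
  obtain ⟨t, ht, hcov⟩ := hcomp.elim_nhds_subcover U hU
  refine t.finite_toSet.subset fun x hx => ?_
  obtain ⟨z, hz, hxz⟩ := mem_iUnion₂.1 (hcov hx)
  have : x = z := hinj z (ht z hz) hxz (mem_of_mem_nhds (hU z (ht z hz)))
    ((hx.2 : φ x = 0).trans (ht z hz).2.symm)
  rwa [this]

/-- Against a density concentrated near `0`, the degree integral computes the signed count of the
zeros: by the change of variables formula each zero contributes its sign. -/
lemma exists_integral_eq_signedCount {φ : (V → ℝ) → (V → ℝ)} (hφ : ContDiff ℝ ∞ φ)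
    {N : Set (V → ℝ)} (hNo : IsOpen N) (hN : IsCompact (closure N))
    (hfr : ∀ x ∈ frontier N, φ x ≠ 0) (hreg : ∀ x ∈ N, φ x = 0 → (fderiv ℝ φ x).det ≠ 0) :
    ∃ r > 0, ∀ h : (V → ℝ) → ℝ, Continuous h → (∀ y, r ≤ ‖y‖ → h y = 0) →
      ∫ x in N, h (φ x) * (fderiv ℝ φ x).det = signedCount φ N * ∫ y, h y := by
  have hfin := finite_zeros_of_regular hφ hNo hN hfr hreg
  obtain ⟨S, hS, hSd⟩ := hfin.t2_separation
  have hloc : ∀ z ∈ N ∩ φ ⁻¹' {0}, ∃ W, IsOpen W ∧ z ∈ W ∧ W ⊆ N ∩ S z ∧ InjOn φ W ∧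
      ∀ x ∈ W, SignType.sign (fderiv ℝ φ x).det = SignType.sign (fderiv ℝ φ z).det :=
    fun z hz => exists_injOn_of_det_ne_zero hφ (hreg z hz.1 hz.2)
      (inter_mem (hNo.mem_nhds hz.1) ((hS z).2.mem_nhds (hS z).1))
  choose! W hWo hzW hWN hinj hsign using hloc
  set Zf := hfin.toFinset with hZf
  have hmemZ : ∀ {z}, z ∈ Zf ↔ z ∈ N ∩ φ ⁻¹' {0} := hfin.mem_toFinset
  have hopen : IsOpen (⋃ z ∈ Zf, W z) := isOpen_biUnion fun z hz => hWo z (hmemZ.1 hz)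
  obtain ⟨m, hm, hmle⟩ := (hN.diff hopen).exists_forall_le' (f := fun x => ‖φ x‖) (a := 0)
    hφ.continuous.norm.continuousOn (fun x hx => by
      rw [norm_pos_iff]
      intro h0
      have hxN : x ∈ N := by
        by_contra hxN
        exact hfr x ⟨hx.1, by rwa [hNo.interior_eq]⟩ h0
      exact hx.2 (mem_iUnion₂.2 ⟨x, hmemZ.2 ⟨hxN, h0⟩, hzW x ⟨hxN, h0⟩⟩))
  -- The density has to live inside all the images `φ '' W z`, and away from the values of `φ` on
  -- the rest of `N`.
  have hball : ∀ z ∈ N ∩ φ ⁻¹' {0}, ∀ᶠ r in 𝓝[>] (0 : ℝ), Metric.ball 0 r ⊆ φ '' W z := by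
    intro z hz
    have h1 := image_mem_nhds_of_det_ne_zero hφ (hreg z hz.1 hz.2) ((hWo z hz).mem_nhds (hzW z hz))
    rw [show φ z = 0 from hz.2] at h1
    obtain ⟨ρ, hρ, hsub⟩ := Metric.mem_nhds_iff.1 h1
    filter_upwards [Ioo_mem_nhdsGT hρ] with r hr
    exact (Metric.ball_subset_ball hr.2.le).trans hsub
  obtain ⟨r, hrball, hr0, hrm⟩ :=
    (((eventually_all_finite hfin).2 hball).and (Ioo_mem_nhdsGT hm)).exists
  refine ⟨r, hr0, fun h hh hsupp => ?_⟩
  have hcont : Continuous fun x => h (φ x) * (fderiv ℝ φ x).det :=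
    (hh.comp hφ.continuous).mul
      (ContinuousLinearMap.continuous_det.comp (hφ.continuous_fderiv (by simp)))
  have hint : IntegrableOn (fun x => h (φ x) * (fderiv ℝ φ x).det) (closure N) :=
    hcont.continuousOn.integrableOn_compact hN
  have hsubN : (⋃ z ∈ Zf, W z) ⊆ N :=
    iUnion₂_subset fun z hz => (hWN z (hmemZ.1 hz)).trans inter_subset_left
  rw [setIntegral_eq_of_subset_of_forall_sdiff_eq_zero hNo.measurableSet hsubN,
    integral_biUnion_finset]
  · rw [signedCount, finsum_mem_eq_finite_toFinset_sum _ hfin, Int.cast_sum, Finset.sum_mul]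
    refine Finset.sum_congr rfl fun z hz => ?_
    have hz' := hmemZ.1 hz
    have hcv := integral_image_eq_integral_abs_det_fderiv_smul volume (hWo z hz').measurableSet
      (fun x _ => ((hφ.differentiable (by simp)) x).hasFDerivAt.hasFDerivWithinAt) (hinj z hz') h
    have hall : ∫ y in φ '' W z, h y = ∫ y, h y := by
      refine setIntegral_eq_integral_of_forall_compl_eq_zero fun y hy => hsupp y ?_
      by_contra hlt
      exact hy (hrball z hz' (by simpa using hlt))
    rw [← hall, hcv, ← integral_const_mul]
    refine setIntegral_congr_fun (hWo z hz').measurableSet fun x hx => ?_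
    have h1 : ((SignType.sign (fderiv ℝ φ z).det : ℤ) : ℝ) * |(fderiv ℝ φ x).det| =
        (fderiv ℝ φ x).det := by
      rw [← hsign z hz' x hx]
      simp
    simp only [smul_eq_mul]
    rw [← mul_assoc, h1, mul_comm]
  · exact fun z hz => (hWo z (hmemZ.1 hz)).measurableSet
  · intro z hz w hw hzw
    exact (hSd (hmemZ.1 hz) (hmemZ.1 hw) hzw).mono ((hWN z (hmemZ.1 hz)).trans inter_subset_right)
      ((hWN w (hmemZ.1 hw)).trans inter_subset_right)
  · exact fun z hz => hint.mono_set
      (((hWN z (hmemZ.1 hz)).trans inter_subset_left).trans subset_closure)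
  · intro x hx
    have hle := hmle x ⟨subset_closure hx.1, hx.2⟩
    rw [hsupp _ (hrm.le.trans hle), zero_mul]

/-- The signed count of zeros is invariant under straight-line homotopies without zeros on the
frontier. -/
lemma signedCount_eq_of_homotopy {φ₀ φ₁ : (V → ℝ) → (V → ℝ)} (hφ₀ : ContDiff ℝ ∞ φ₀)
    (hφ₁ : ContDiff ℝ ∞ φ₁) {N : Set (V → ℝ)} (hNo : IsOpen N) (hN : IsCompact (closure N))
    (hfr : ∀ t ∈ Icc (0 : ℝ) 1, ∀ x ∈ frontier N, φ₀ x + t • (φ₁ x - φ₀ x) ≠ 0)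
    (hreg₀ : ∀ x ∈ N, φ₀ x = 0 → (fderiv ℝ φ₀ x).det ≠ 0)
    (hreg₁ : ∀ x ∈ N, φ₁ x = 0 → (fderiv ℝ φ₁ x).det ≠ 0) :
    signedCount φ₀ N = signedCount φ₁ N := by
  classical
  have hψ : Continuous fun q : ℝ × (V → ℝ) => φ₀ q.2 + q.1 • (φ₁ q.2 - φ₀ q.2) := by
    have := hφ₀.continuous; have := hφ₁.continuous; fun_prop
  have hfrc : IsCompact (frontier N) :=
    hN.of_isClosed_subset isClosed_frontier frontier_subset_closure
  obtain ⟨m, hm, hmle⟩ := (isCompact_Icc.prod hfrc).exists_forall_le' (a := 0)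
    (f := fun q : ℝ × (V → ℝ) => ‖φ₀ q.2 + q.1 • (φ₁ q.2 - φ₀ q.2)‖)
    hψ.norm.continuousOn (fun q hq => norm_pos_iff.2 (hfr q.1 hq.1 q.2 hq.2))
  obtain ⟨r₀, hr₀, hint₀⟩ := exists_integral_eq_signedCount hφ₀ hNo hN
    (fun x hx => by simpa using hfr 0 (by simp) x hx) hreg₀
  obtain ⟨r₁, hr₁, hint₁⟩ := exists_integral_eq_signedCount hφ₁ hNo hN
    (fun x hx => by simpa using hfr 1 (by simp) x hx) hreg₁
  set r := min (m / 2) (min r₀ r₁) with hr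
  have hr0 : 0 < r := lt_min (half_pos hm) (lt_min hr₀ hr₁)
  -- A bump function serves as the density.
  let b : ContDiffBump (0 : V → ℝ) := ⟨r / 2, r, half_pos hr0, half_lt_self hr0⟩
  have hb : ContDiff ℝ ∞ b := b.contDiff
  have hbz : ∀ y : V → ℝ, r ≤ ‖y‖ → b y = 0 := fun y hy => b.zero_of_le_dist (by simpa using hy)
  have hbpos : 0 < ∫ y, b y := b.integral_pos
  -- The points at which some stage of the homotopy enters the support of the density.
  set K : Set (V → ℝ) := Prod.snd '' ((Icc (0 : ℝ) 1 ×ˢ closure N) ∩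
    {q | ‖φ₀ q.2 + q.1 • (φ₁ q.2 - φ₀ q.2)‖ ≤ r}) with hK
  have hKc : IsCompact K := ((isCompact_Icc.prod hN).inter_right
    (isClosed_le hψ.norm continuous_const)).image continuous_snd
  have hKN : K ⊆ N := by
    rintro x ⟨⟨t, x⟩, ⟨⟨ht, hx⟩, hle⟩, rfl⟩
    by_contra hxN
    have h1 := hmle (t, x) ⟨ht, hx, by rwa [hNo.interior_eq]⟩
    have h2 : r ≤ m / 2 := min_le_left _ _
    have hle' : ‖φ₀ x + t • (φ₁ x - φ₀ x)‖ ≤ r := hle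
    simp only at h1
    linarith
  obtain ⟨N', hN'o, hKN', hN'N, hN'c⟩ := exists_open_between_and_isCompact_closure hKc hNo hKN
  obtain ⟨χ, hχ1, hχ0, -⟩ := exists_contMDiffMap_one_nhds_of_subset_interior
    (modelWithCornersSelf ℝ (V → ℝ)) (n := ⊤) hKc.isClosed (t := N')
    (by rwa [hN'o.interior_eq])
  have hχ : ContDiff ℝ ∞ χ := χ.contMDiff.contDiff
  have hχsupp : tsupport χ ⊆ closure N' :=
    closure_mono fun x hx => by_contra fun h => hx (hχ0 x h)
  have hχc : HasCompactSupport χ := hN'c.of_isClosed_subset (isClosed_tsupport _) hχsupp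
  have hχK : ∀ x ∈ K, ∀ᶠ y in 𝓝 x, χ y = 1 := fun x hx => by
    rw [eventually_nhdsSet_iff_forall] at hχ1; exact hχ1 x hx
  have hout : ∀ t ∈ Icc (0 : ℝ) 1, ∀ x ∈ N, x ∉ K → b (φ₀ x + t • (φ₁ x - φ₀ x)) = 0 := by
    intro t ht x hx hxK
    refine hbz _ (le_of_not_ge fun hle => hxK ⟨(t, x), ⟨⟨ht, subset_closure hx⟩, hle⟩, rfl⟩)
  have hkey := integral_comp_mul_det_eq hφ₀ hφ₁ hb hχ hχc (fun t ht x => by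
    by_cases hxN : x ∈ N
    · by_cases hxK : x ∈ K
      · rw [(EventuallyEq.fderiv_eq (f := fun _ => (1 : ℝ)) (hχK x hxK)), fderiv_const_apply,
          smul_zero]
      · rw [hout t ht x hxN hxK, zero_smul]
    · rw [image_eq_zero_of_notMem_tsupport
        (fun h => hxN (hN'N (hχsupp (tsupport_fderiv_subset ℝ h)))), smul_zero])
  -- On `N` the cutoff is invisible.
  have hcut : ∀ φ : (V → ℝ) → (V → ℝ), (∀ x ∈ N, x ∉ K → b (φ x) = 0) →
      ∫ x, χ x * b (φ x) * (fderiv ℝ φ x).det = ∫ x in N, b (φ x) * (fderiv ℝ φ x).det := by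
    intro φ hφ
    rw [← setIntegral_eq_integral_of_forall_compl_eq_zero (s := N)]
    · refine setIntegral_congr_fun hNo.measurableSet fun x hx => ?_
      by_cases hxK : x ∈ K
      · simp only [(hχK x hxK).self_of_nhds, one_mul]
      · simp only [hφ x hx hxK, mul_zero]
    · intro x hx
      rw [hχ0 x fun h => hx (hN'N (subset_closure h)), zero_mul, zero_mul]
  rw [hcut φ₀ fun x hx hxK => by simpa using hout 0 (by simp) x hx hxK,
    hcut φ₁ fun x hx hxK => by simpa using hout 1 (by simp) x hx hxK,
    hint₀ b b.continuous fun y hy => hbz y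
      (((min_le_right _ _).trans (min_le_left _ _)).trans hy),
    hint₁ b b.continuous fun y hy => hbz y
      (((min_le_right _ _).trans (min_le_right _ _)).trans hy)] at hkey
  exact_mod_cast mul_right_cancel₀ hbpos.ne' hkey

end LocalDegree

/-! ### The Brouwer degree -/

section BrouwerDegree

variable {V : Type*} [Fintype V]

/-- Smooth approximation by maps with `0` as a regular value, by Sard's theorem. -/
lemma exists_contDiff_regular_approx {ψ : (V → ℝ) → (V → ℝ)} {K : Set (V → ℝ)} (hK : IsClosed K)
    (hψ : ContinuousOn ψ K) {ε : ℝ} (hε : 0 < ε) :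
    ∃ φ : (V → ℝ) → (V → ℝ), ContDiff ℝ ∞ φ ∧ (∀ x ∈ K, ‖φ x - ψ x‖ < ε) ∧
      ∀ x, φ x = 0 → (fderiv ℝ φ x).det ≠ 0 := by
  obtain ⟨g, hg⟩ := ContinuousMap.exists_restrict_eq hK ⟨K.domRestrict ψ, hψ.domRestrict⟩
  have hgψ : ∀ x ∈ K, g x = ψ x := fun x hx => congrArg (fun f => f ⟨x, hx⟩) hg
  obtain ⟨φ, hφ, hφg, -⟩ := g.continuous.exists_contDiff_approx ⊤ (ε := fun _ => ε / 2)
    continuous_const fun _ => half_pos hε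
  have hsard : volume (φ '' {x | (fderiv ℝ φ x).det = 0}) = 0 :=
    addHaar_image_eq_zero_of_det_fderivWithin_eq_zero volume
      (fun x _ => ((hφ.differentiable (by simp)) x).hasFDerivAt.hasFDerivWithinAt) fun x hx => hx
  obtain ⟨c, hc, hcreg⟩ : ∃ c ∈ Metric.ball (0 : V → ℝ) (ε / 2),
      c ∉ φ '' {x | (fderiv ℝ φ x).det = 0} := by
    by_contra! h
    exact (Metric.measure_ball_pos volume (0 : V → ℝ) (half_pos hε)).ne'
      (measure_mono_null h hsard)
  refine ⟨fun x => φ x - c, hφ.sub contDiff_const, fun x hx => ?_, fun x hx h0 => ?_⟩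
  · have h1 := hφg x
    rw [hgψ x hx, dist_eq_norm] at h1
    have h2 : ‖c‖ < ε / 2 := by simpa using hc
    calc ‖φ x - c - ψ x‖ = ‖(φ x - ψ x) - c‖ := by congr 1; abel
      _ ≤ ‖φ x - ψ x‖ + ‖c‖ := norm_sub_le _ _
      _ < ε := by linarith
  · rw [fderiv_sub_const] at h0
    exact hcreg ⟨x, h0, sub_eq_zero.1 hx⟩

/-- All sufficiently close smooth approximations of `ψ` with regular value `0` have signed count `d`
on `N`. -/
def HasApproxCount (ψ : (V → ℝ) → (V → ℝ)) (N : Set (V → ℝ)) (d : ℤ) : Prop :=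
  ∃ ε : ℝ, 0 < ε ∧ ∀ φ : (V → ℝ) → (V → ℝ), ContDiff ℝ ∞ φ →
    (∀ x ∈ closure N, ‖φ x - ψ x‖ < ε) →
    (∀ x ∈ N, φ x = 0 → (fderiv ℝ φ x).det ≠ 0) →
    (N ∩ φ ⁻¹' {0}).Finite ∧ signedCount φ N = d

lemma HasApproxCount.congr {ψ ψ' : (V → ℝ) → (V → ℝ)} {N : Set (V → ℝ)} {d : ℤ}
    (h : HasApproxCount ψ N d) (heq : EqOn ψ ψ' (closure N)) : HasApproxCount ψ' N d := by
  obtain ⟨ε, hε, H⟩ := h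
  exact ⟨ε, hε, fun φ hφ hc => H φ hφ fun x hx => by rw [heq hx]; exact hc x hx⟩

lemma exists_hasApproxCount {ψ : (V → ℝ) → (V → ℝ)} {N : Set (V → ℝ)} (hNo : IsOpen N)
    (hN : IsCompact (closure N)) (hψ : ContinuousOn ψ (closure N))
    (hfr : ∀ x ∈ frontier N, ψ x ≠ 0) : ∃ d, HasApproxCount ψ N d := by
  have hfrc : IsCompact (frontier N) :=
    hN.of_isClosed_subset isClosed_frontier frontier_subset_closure
  obtain ⟨m, hm, hmle⟩ := hfrc.exists_forall_le' (a := 0) (f := fun x => ‖ψ x‖)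
    (hψ.mono frontier_subset_closure).norm fun x hx => norm_pos_iff.2 (hfr x hx)
  obtain ⟨φ₀, hφ₀, hc₀, hreg₀⟩ := exists_contDiff_regular_approx isClosed_closure hψ hm
  have hne : ∀ φ : (V → ℝ) → (V → ℝ), (∀ x ∈ closure N, ‖φ x - ψ x‖ < m) →
      ∀ x ∈ frontier N, φ x ≠ 0 := by
    intro φ hc x hx h0
    have h1 := hc x (frontier_subset_closure hx)
    rw [h0, zero_sub, norm_neg] at h1
    exact (hmle x hx).not_gt h1
  -- The minimum `m` of `‖ψ‖` on the frontier serves as the tolerance.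
  refine ⟨signedCount φ₀ N, m, hm, fun φ hφ hc hreg =>
    ⟨finite_zeros_of_regular hφ hNo hN (hne φ hc) hreg, ?_⟩⟩
  refine signedCount_eq_of_homotopy hφ hφ₀ hNo hN (fun t ht => ?_) hreg fun x _ => hreg₀ x
  refine hne (fun x => φ x + t • (φ₀ x - φ x)) fun x hx => ?_
  -- The ball of radius `m` around `ψ x` is convex.
  have h1 := (convex_ball (ψ x) m).add_smul_sub_mem (mem_ball_iff_norm.2 (hc x hx))
    (mem_ball_iff_norm.2 (hc₀ x hx)) ht
  exact mem_ball_iff_norm.1 h1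

/-- Excision for approximate counts. -/
lemma HasApproxCount.eq_of_subset {ψ : (V → ℝ) → (V → ℝ)} {N N' : Set (V → ℝ)} {d d' : ℤ}
    (h : HasApproxCount ψ N d) (h' : HasApproxCount ψ N' d') (hN'o : IsOpen N') (hsub : N' ⊆ N)
    (hN : IsCompact (closure N)) (hψ : ContinuousOn ψ (closure N))
    (hz : ∀ x ∈ closure N, ψ x = 0 → x ∈ N') : d = d' := by
  obtain ⟨m, hm, hmle⟩ := (hN.diff hN'o).exists_forall_le' (a := 0) (f := fun x => ‖ψ x‖)
    (hψ.mono sdiff_subset).norm fun x hx => norm_pos_iff.2 fun h0 => hx.2 (hz x hx.1 h0)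
  obtain ⟨ε, hε, H⟩ := h
  obtain ⟨ε', hε', H'⟩ := h'
  -- A single approximation computes both counts, as it has no zeros outside `N'`.
  obtain ⟨φ, hφ, hc, hreg⟩ := exists_contDiff_regular_approx isClosed_closure hψ
    (lt_min hm (lt_min hε hε'))
  have h1 := (H φ hφ (fun x hx => (hc x hx).trans_le
    ((min_le_right _ _).trans (min_le_left _ _))) fun x _ => hreg x).2
  have h2 := (H' φ hφ (fun x hx => (hc x (closure_mono hsub hx)).trans_le
    ((min_le_right _ _).trans (min_le_right _ _))) fun x _ => hreg x).2
  have hset : N ∩ φ ⁻¹' {0} = N' ∩ φ ⁻¹' {0} := by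
    refine Subset.antisymm (fun x hx => ⟨?_, hx.2⟩) (inter_subset_inter_left _ hsub)
    by_contra hxN'
    have h3 := hc x (subset_closure hx.1)
    rw [show φ x = 0 from hx.2, zero_sub, norm_neg] at h3
    exact ((h3.trans_le (min_le_left _ _)).trans_le (hmle x ⟨subset_closure hx.1, hxN'⟩)).false
  rw [← h1, ← h2, signedCount, signedCount, hset]

lemma isBrouwerDegree_iff {ψ : (V → ℝ) → (V → ℝ)} {Ω : Set (V → ℝ)} {d : ℤ} :
    IsBrouwerDegree ψ Ω d ↔ ∃ N : Set (V → ℝ), IsOpen N ∧ IsCompact (closure N) ∧ closure N ⊆ Ω ∧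
      Ω ∩ ψ ⁻¹' {0} ⊆ N ∧ ContinuousOn ψ (closure N) ∧ HasApproxCount ψ N d :=
  Iff.rfl

theorem exists_isBrouwerDegree {ψ : (V → ℝ) → (V → ℝ)} {Ω : Set (V → ℝ)} (hΩ : IsOpen Ω)
    (hψ : ContinuousOn ψ Ω) (hZ : IsCompact (Ω ∩ ψ ⁻¹' {0})) : ∃ d, IsBrouwerDegree ψ Ω d := by
  obtain ⟨N, hNo, hZN, hNΩ, hN⟩ := exists_open_between_and_isCompact_closure hZ hΩ inter_subset_left
  obtain ⟨d, hd⟩ := exists_hasApproxCount hNo hN (hψ.mono hNΩ) fun x hx h0 =>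
    hx.2 (by rw [hNo.interior_eq]; exact hZN ⟨hNΩ hx.1, h0⟩)
  exact ⟨d, isBrouwerDegree_iff.2 ⟨N, hNo, hN, hNΩ, hZN, hψ.mono hNΩ, hd⟩⟩

/-- The degree depends only on the germ of the map along its set of zeros. -/
theorem IsBrouwerDegree.eq_of_eqOn {ψ ψ' : (V → ℝ) → (V → ℝ)} {Ω Ω' O : Set (V → ℝ)} {d d' : ℤ}
    (h : IsBrouwerDegree ψ Ω d) (h' : IsBrouwerDegree ψ' Ω' d') (hO : IsOpen O)
    (hZ : Ω ∩ ψ ⁻¹' {0} ⊆ O) (hZ' : Ω' ∩ ψ' ⁻¹' {0} = Ω ∩ ψ ⁻¹' {0}) (heq : EqOn ψ ψ' O) :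
    d = d' := by
  obtain ⟨N, hNo, hN, hNΩ, hZN, hψ, hd⟩ := isBrouwerDegree_iff.1 h
  obtain ⟨N', hN'o, hN', hN'Ω, hZN', hψ', hd'⟩ := isBrouwerDegree_iff.1 h'
  have hZc : IsCompact (Ω ∩ ψ ⁻¹' {0}) := by
    have : Ω ∩ ψ ⁻¹' {0} = closure N ∩ ψ ⁻¹' {0} :=
      Subset.antisymm (fun x hx => ⟨subset_closure (hZN hx), hx.2⟩)
        (inter_subset_inter_left _ hNΩ)
    rw [this]
    exact hN.of_isClosed_subset
      (hψ.preimage_isClosed_of_isClosed isClosed_closure isClosed_singleton) inter_subset_left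
  -- Compare both degrees with a count on a smaller neighbourhood `N₁` of the zeros.
  obtain ⟨N₁, hN₁o, hZN₁, hN₁sub, hN₁⟩ := exists_open_between_and_isCompact_closure hZc
    ((hNo.inter hN'o).inter hO) (subset_inter (subset_inter hZN (hZ' ▸ hZN')) hZ)
  have hN₁N : closure N₁ ⊆ N := fun x hx => (hN₁sub hx).1.1
  have hN₁N' : closure N₁ ⊆ N' := fun x hx => (hN₁sub hx).1.2
  obtain ⟨d₁, hd₁⟩ := exists_hasApproxCount hN₁o hN₁
    (hψ.mono (hN₁N.trans subset_closure)) fun x hx h0 =>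
      hx.2 (by rw [hN₁o.interior_eq]; exact hZN₁ ⟨hNΩ (subset_closure (hN₁N hx.1)), h0⟩)
  rw [hd.eq_of_subset hd₁ hN₁o (subset_closure.trans hN₁N) hN hψ
    fun x hx h0 => hZN₁ ⟨hNΩ hx, h0⟩]
  exact ((hd'.eq_of_subset (hd₁.congr fun x hx => heq (hN₁sub hx).2) hN₁o
    (subset_closure.trans hN₁N') hN' hψ' fun x hx h0 => hZN₁ (hZ' ▸ ⟨hN'Ω hx, h0⟩))).symm

/-- Continuation of the degree in a family whose total set of zeros is compact. -/
theorem IsBrouwerDegree.eventually {P : Type*} [TopologicalSpace P] [T2Space P]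
    {ψ : P → (V → ℝ) → (V → ℝ)} {Ω : Set (P × (V → ℝ))} (hΩ : IsOpen Ω)
    (hψ : ContinuousOn (Function.uncurry ψ) Ω) (hZ : IsCompact (Ω ∩ Function.uncurry ψ ⁻¹' {0}))
    {t₀ : P} {d : ℤ} (h : IsBrouwerDegree (ψ t₀) {x | (t₀, x) ∈ Ω} d) :
    ∀ᶠ t in 𝓝 t₀, IsBrouwerDegree (ψ t) {x | (t, x) ∈ Ω} d := by
  obtain ⟨N, hNo, hN, hNΩ, hZN, hcN, ε, hε, H⟩ := h
  -- The same neighbourhood `N` works for nearby parameters, with half the tolerance.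
  have h1 : ∀ᶠ t in 𝓝 t₀, ∀ x ∈ closure N, (t, x) ∈ Ω :=
    hN.eventually_forall_of_forall_eventually fun x hx => hΩ.mem_nhds (hNΩ hx)
  have h2 : ∀ᶠ t in 𝓝 t₀, ∀ x ∈ closure N, ‖ψ t x - ψ t₀ x‖ < ε / 2 := by
    refine hN.eventually_forall_of_forall_eventually fun x hx => ?_
    have hc : ContinuousAt (Function.uncurry ψ) (t₀, x) := hψ.continuousAt (hΩ.mem_nhds (hNΩ hx))
    have hc' : ContinuousAt (fun q : P × (V → ℝ) => ψ t₀ q.2) (t₀, x) :=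
      ContinuousAt.comp (f := fun q : P × (V → ℝ) => (t₀, q.2)) (g := Function.uncurry ψ) hc
        (by fun_prop)
    have := (hc.sub hc').norm
    refine this.eventually_lt continuousAt_const ?_
    simpa [Function.uncurry] using half_pos hε
  have h3 : ∀ᶠ t in 𝓝 t₀, t ∉ Prod.fst '' ((Ω ∩ Function.uncurry ψ ⁻¹' {0}) \ (univ ×ˢ N)) := by
    refine ((hZ.diff (isOpen_univ.prod hNo)).image continuous_fst).isClosed.isOpen_compl.mem_nhds ?_
    rintro ⟨⟨t, x⟩, ⟨⟨hx, h0⟩, hxN⟩, rfl⟩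
    exact hxN ⟨trivial, hZN ⟨hx, h0⟩⟩
  filter_upwards [h1, h2, h3] with t ht1 ht2 ht3
  refine ⟨N, hNo, hN, ht1, fun x hx => ?_, ?_, ε / 2, half_pos hε, fun φ hφ hc hreg => ?_⟩
  · by_contra hxN
    exact ht3 ⟨(t, x), ⟨⟨hx.1, hx.2⟩, fun h => hxN h.2⟩, rfl⟩
  · exact hψ.comp (f := fun x => (t, x)) (by fun_prop) ht1
  · refine H φ hφ (fun x hx => ?_) hreg
    calc ‖φ x - ψ t₀ x‖ = ‖(φ x - ψ t x) + (ψ t x - ψ t₀ x)‖ := by congr 1; abel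
      _ ≤ _ := norm_add_le _ _
      _ < ε := by linarith [hc x hx, ht2 x hx]

end BrouwerDegree

/-! ### Topology of configuration spaces -/

section ConfigurationTopology

variable {n : ℕ} {Y : Type*}

/-- The unordered configuration of an ordered configuration. -/
def unorder (y : OrdConf n Y) : UConf n Y :=
  Quotient.mk (reorderSetoid n Y) y

lemma toSet_unorder (y : OrdConf n Y) : (unorder y).toSet = range y.1 := rfl

lemma unorder_surjective : Function.Surjective (unorder (n := n) (Y := Y)) :=
  Quotient.mk_surjective

lemma unorder_eq_iff {y z : OrdConf n Y} :
    unorder y = unorder z ↔ ∃ σ : Equiv.Perm (Fin n), z.1 = y.1 ∘ σ :=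
  Quotient.eq (r := reorderSetoid n Y)

variable [TopologicalSpace Y]

lemma isOpenQuotientMap_unorder : IsOpenQuotientMap (unorder (n := n) (Y := Y)) where
  surjective := unorder_surjective
  continuous := continuous_quotient_mk'
  isOpenMap := by
    intro U hU
    change IsOpen ((unorder (n := n) (Y := Y)) ⁻¹' (unorder '' U))
    have : (unorder (n := n) (Y := Y)) ⁻¹' (unorder '' U) = ⋃ σ : Equiv.Perm (Fin n),
        (fun y : OrdConf n Y => (⟨y.1 ∘ σ, y.2.comp σ.injective⟩ : OrdConf n Y)) ⁻¹' U := by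
      ext y
      simp only [mem_preimage, mem_image, mem_iUnion]
      constructor
      · rintro ⟨z, hz, h⟩
        obtain ⟨σ, hσ⟩ := unorder_eq_iff.1 h.symm
        exact ⟨σ, by convert hz using 1; exact Subtype.ext hσ.symm⟩
      · rintro ⟨σ, h⟩
        exact ⟨_, h, (unorder_eq_iff.2 ⟨σ, rfl⟩).symm⟩
    rw [this]
    refine isOpen_iUnion fun σ => hU.preimage (Continuous.subtype_mk ?_ _)
    exact continuous_pi fun i => (continuous_apply (σ i)).comp continuous_subtype_val

/-- The graph of the membership relation is closed. -/
lemma isClosed_mem_toSet [T2Space Y] : IsClosed {a : Y × UConf n Y | a.1 ∈ a.2.toSet} := by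
  have hq := (IsOpenQuotientMap.id (X := Y)).prodMap (isOpenQuotientMap_unorder (n := n) (Y := Y))
  rw [← hq.isQuotientMap.isClosed_preimage]
  have : Prod.map id unorder ⁻¹' {a : Y × UConf n Y | a.1 ∈ a.2.toSet} =
      ⋃ k : Fin n, {b : Y × OrdConf n Y | b.2.1 k = b.1} := by
    ext ⟨x, y⟩
    simp [toSet_unorder]
  rw [this]
  refine isClosed_iUnion_of_finite fun k => isClosed_eq ?_ continuous_fst
  exact (continuous_apply k).comp (continuous_subtype_val.comp continuous_snd)

/-- Near a point of a configuration, nearby configurations have at most one point. -/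
lemma exists_nhds_toSet_subsingleton [T2Space Y] {q : UConf n Y} {y : Y} (hy : y ∈ q.toSet) :
    ∃ O ∈ 𝓝 y, ∃ Q ∈ 𝓝 q, ∀ q' ∈ Q, (O ∩ q'.toSet).Subsingleton := by
  obtain ⟨z, rfl⟩ := unorder_surjective q
  obtain ⟨k, rfl⟩ := hy
  obtain ⟨S, hS, hSd⟩ := (finite_range z.1).t2_separation
  have hopen : IsOpen {z' : OrdConf n Y | ∀ j, z'.1 j ∈ S (z.1 j)} := by
    simp only [ofPred_forall]
    exact isOpen_iInter_of_finite fun j => (hS _).2.preimage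
      ((continuous_apply j).comp continuous_subtype_val)
  refine ⟨S (z.1 k), (hS _).2.mem_nhds (hS _).1, _,
    (isOpenQuotientMap_unorder.isOpenMap _ hopen).mem_nhds ⟨z, fun j => (hS _).1, rfl⟩, ?_⟩
  rintro _ ⟨z', hz', rfl⟩
  have key : ∀ a ∈ S (z.1 k) ∩ (unorder z').toSet, a = z'.1 k := by
    rintro _ ⟨haS, j, rfl⟩
    by_contra hne
    have hjk : z.1 j ≠ z.1 k := fun h => hne (congrArg z'.1 (z.2 h))
    exact (hSd ⟨j, rfl⟩ ⟨k, rfl⟩ hjk).le_bot ⟨hz' j, haS⟩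
  intro a ha b hb
  rw [key a ha, key b hb]

/-- The nearest-point selection: on an open neighbourhood of the membership relation, the point of a
configuration nearest to a given point depends continuously on both. -/
lemma exists_nearest_selection (n : ℕ) (Y : Type*) [TopologicalSpace Y]
    [TopologicalSpace.MetrizableSpace Y] :
    ∃ (A : Set (Y × UConf n Y)) (s : Y × UConf n Y → Y), IsOpen A ∧ ContinuousOn s A ∧
      (∀ a ∈ A, s a ∈ a.2.toSet) ∧ ∀ x : Y, ∀ q : UConf n Y, x ∈ q.toSet →
        (x, q) ∈ A ∧ s (x, q) = x := by
  classical
  let _ := TopologicalSpace.metrizableSpaceMetric Y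
  have hπ := (IsOpenQuotientMap.id (X := Y)).prodMap (isOpenQuotientMap_unorder (n := n) (Y := Y))
  -- `N a y` says that `y` is the unique point of the configuration `a.2` nearest to `a.1`.
  set N : Y × UConf n Y → Y → Prop := fun a y =>
    y ∈ a.2.toSet ∧ ∀ z ∈ a.2.toSet, z ≠ y → dist a.1 y < dist a.1 z with hN
  have huniq : ∀ {a y z}, N a y → N a z → y = z := by
    intro a y z hy hz
    by_contra hne
    exact lt_asymm (hy.2 z hz.1 (Ne.symm hne)) (hz.2 y hy.1 hne)
  set s : Y × UConf n Y → Y := fun a => if h : ∃ y, N a y then h.choose else a.1 with hs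
  have hsN : ∀ {a y}, N a y → s a = y := by
    intro a y hy
    have h : ∃ y, N a y := ⟨y, hy⟩
    simp only [hs, dif_pos h]
    exact huniq h.choose_spec hy
  -- Upstairs, on the open set `B k`, the nearest point is the `k`-th coordinate.
  set B : Fin n → Set (Y × OrdConf n Y) := fun k =>
    {b | ∀ j, j ≠ k → dist b.1 (b.2.1 k) < dist b.1 (b.2.1 j)} with hB
  have hev : ∀ k, Continuous fun b : Y × OrdConf n Y => b.2.1 k := fun k =>
    (continuous_apply k).comp (continuous_subtype_val.comp continuous_snd)
  have hBo : ∀ k, IsOpen (B k) := by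
    intro k
    simp only [hB, ofPred_forall]
    exact isOpen_iInter_of_finite fun j => isOpen_iInter_of_finite fun _ =>
      isOpen_lt (continuous_fst.dist (hev k)) (continuous_fst.dist (hev j))
  have hBN : ∀ {k b}, b ∈ B k → N (Prod.map id unorder b) (b.2.1 k) := by
    rintro k ⟨x, y⟩ hb
    refine ⟨⟨k, rfl⟩, ?_⟩
    rintro _ ⟨j, rfl⟩ hne
    exact hb j fun h => hne (by rw [h])
  have hA : {a : Y × UConf n Y | ∃ y, N a y} = Prod.map id unorder '' ⋃ k, B k := by
    ext ⟨x, q⟩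
    constructor
    · rintro ⟨y, hy⟩
      obtain ⟨z, rfl⟩ := unorder_surjective q
      obtain ⟨k, rfl⟩ := hy.1
      exact ⟨(x, z), mem_iUnion.2 ⟨k, fun j hj => hy.2 _ ⟨j, rfl⟩ fun h => hj (z.2 h)⟩, rfl⟩
    · rintro ⟨b, hb, hbx⟩
      obtain ⟨k, hk⟩ := mem_iUnion.1 hb
      exact ⟨_, hbx ▸ hBN hk⟩
  refine ⟨{a | ∃ y, N a y}, s, hA ▸ hπ.isOpenMap _ (isOpen_iUnion hBo), ?_, ?_, ?_⟩
  · intro a ha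
    rw [hA] at ha
    obtain ⟨b, hb, rfl⟩ := ha
    obtain ⟨k, hk⟩ := mem_iUnion.1 hb
    refine ContinuousAt.continuousWithinAt ?_
    have h1 : Tendsto (s ∘ Prod.map id unorder) (𝓝 b) (𝓝 (s (Prod.map id unorder b))) := by
      rw [hsN (hBN hk)]
      refine (hev k).continuousAt.tendsto.congr' ?_
      filter_upwards [(hBo k).mem_nhds hk] with b' hb'
      exact (hsN (hBN hb')).symm
    exact (tendsto_map'_iff.2 h1).mono_left (hπ.isOpenMap.nhds_le b)
  · rintro a ⟨y, hy⟩
    rw [hsN hy]; exact hy.1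
  · intro x q hx
    have : N (x, q) x := ⟨hx, fun z _ hne => by simpa using hne.symm⟩
    exact ⟨⟨x, this⟩, hsN this⟩

end ConfigurationTopology

/-! ### Finite polyhedra and coverings -/

section PolyhedronTopology

variable {X V : Type*} [TopologicalSpace X] [Fintype V]

lemma isCompact_realization (K : AbstractSimplicialComplex V) : IsCompact (realization K) := by
  have : realization K = stdSimplex ℝ V ∩
      ⋃ s ∈ K.faces, {x : V → ℝ | ∀ v, v ∉ s → x v = 0} := by
    ext x
    simp only [realization, stdSimplex, mem_inter_iff, mem_iUnion, mem_ofPred_eq, exists_prop,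
      and_assoc]
  rw [this]
  refine (isCompact_stdSimplex ℝ V).inter_right ?_
  refine (Set.toFinite K.faces).isClosed_biUnion fun s _ => ?_
  simp only [ofPred_forall]
  exact isClosed_iInter fun v => isClosed_iInter fun _ =>
    isClosed_eq (continuous_apply v) continuous_const

lemma Triangulation.compactSpace (T : Triangulation X V) : CompactSpace X :=
  have := isCompact_iff_compactSpace.1 (isCompact_realization T.complex)
  T.homeo.symm.compactSpace

lemma Triangulation.t2Space (T : Triangulation X V) : T2Space X :=
  T.homeo.isEmbedding.t2Space

lemma Triangulation.metrizableSpace (T : Triangulation X V) :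
    TopologicalSpace.MetrizableSpace X :=
  T.homeo.isEmbedding.metrizableSpace

/-- A finite polyhedron is a retract of an open subset of a Euclidean space. -/
lemma Triangulation.locallyPathConnectedSpace (T : Triangulation X V) :
    LocallyPathConnectedSpace X := by
  have := (isOpen_retractDomain T.complex).locallyPathConnectedSpace
  have hq : IsQuotientMap (retract T.complex) := by
    refine IsQuotientMap.of_comp (f := fun x : realization T.complex =>
      (⟨x.1, realization_subset_retractDomain T.complex x.2⟩ : retractDomain T.complex))
      (Continuous.subtype_mk continuous_subtype_val _) (continuous_retract T.complex) ?_
    have : (retract T.complex ∘ fun x : realization T.complex =>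
      (⟨x.1, realization_subset_retractDomain T.complex x.2⟩ : retractDomain T.complex)) = id :=
      funext fun x => retract_eq_self T.complex x
    rw [this]
    exact IsQuotientMap.id
  exact (T.homeo.symm.isQuotientMap.comp hq).locallyPathConnectedSpace

end PolyhedronTopology

section OrbitConfigurations

variable {X E : Type*} {p : E → X} {n : ℕ}

lemma orbitProj_eq_unorder (x : OrbitConf n p) : orbitProj n p x = unorder ⟨p ∘ x.1, x.2⟩ := rfl

lemma mem_toSet_orbitProj {x : OrbitConf n p} {y : X} :
    y ∈ (orbitProj n p x).toSet ↔ ∃ k, p (x.1 k) = y := Iff.rfl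

variable [TopologicalSpace E]

lemma orbitProj_wreathAct (a : Wreath n (Deck p)) (x : OrbitConf n p) :
    orbitProj n p (wreathAct a x) = orbitProj n p x := by
  rw [orbitProj_eq_unorder, orbitProj_eq_unorder, eq_comm, unorder_eq_iff]
  exact ⟨a.right⁻¹, funext fun k => (a.left k).2 _⟩

lemma continuous_wreathAct (a : Wreath n (Deck p)) :
    Continuous (wreathAct (n := n) (p := p) a) := by
  refine Continuous.subtype_mk (continuous_pi fun k => ?_) _
  exact (a.left k : E ≃ₜ E).continuous.comp
    ((continuous_apply _).comp continuous_subtype_val)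

end OrbitConfigurations

section Coverings

variable {X E : Type*} [TopologicalSpace X] [TopologicalSpace E] {p : E → X} {n : ℕ}

lemma locallyPathConnectedSpace_of_isLocalHomeomorph [LocallyPathConnectedSpace X]
    (hp : IsLocalHomeomorph p) : LocallyPathConnectedSpace E := by
  refine ⟨fun e => hasBasis_iff.2 fun U => ⟨fun hU => ?_, fun ⟨S, hS, hSU⟩ =>
    mem_of_superset hS.1 hSU⟩⟩
  obtain ⟨φ, he, -⟩ := hp e
  have h1 : φ '' (U ∩ φ.source) ∈ 𝓝 (φ e) :=
    φ.image_mem_nhds he (inter_mem hU (φ.open_source.mem_nhds he))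
  obtain ⟨S, ⟨hS, hSc⟩, hSsub⟩ :=
    (LocallyPathConnectedSpace.path_connected_basis (φ e)).mem_iff.1 h1
  have hSt : S ⊆ φ.target := by
    intro x hx
    obtain ⟨y, hy, rfl⟩ := hSsub hx
    exact φ.map_source hy.2
  refine ⟨φ.symm '' S, ⟨?_, hSc.image' (φ.continuousOn_symm.mono hSt)⟩, ?_⟩
  · have := φ.symm.image_mem_nhds (φ.map_source he) hS
    rwa [φ.left_inv he] at this
  · rintro _ ⟨x, hx, rfl⟩
    obtain ⟨y, hy, rfl⟩ := hSsub hx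
    simpa [φ.left_inv hy.2] using hy.1

lemma t2Space_of_isCoveringMap [T2Space X] (hp : IsCoveringMap p) : T2Space E := by
  refine ⟨fun e e' hne => ?_⟩
  by_cases h : p e = p e'
  · exact hp.isSeparatedMap e e' h hne
  · obtain ⟨U, U', hU, hU', heU, heU', hd⟩ := t2_separation h
    exact ⟨p ⁻¹' U, p ⁻¹' U', hU.preimage hp.continuous, hU'.preimage hp.continuous, heU, heU',
      hd.preimage p⟩

lemma surjective_of_isCoveringMap [PathConnectedSpace X] [Nonempty E] (hp : IsCoveringMap p) :
    Function.Surjective p := by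
  intro x
  obtain ⟨e⟩ := ‹Nonempty E›
  obtain ⟨Γ, hΓ, -⟩ := hp.exists_path_lifts (PathConnectedSpace.somePath (p e) x) e (by simp)
  exact ⟨Γ 1, by simpa using congrFun hΓ 1⟩

lemma deck_ext [PreconnectedSpace E] (hp : IsCoveringMap p) {α β : Deck p} {e : E}
    (h : (α : E ≃ₜ E) e = (β : E ≃ₜ E) e) : α = β := by
  have h1 := hp.eq_of_comp_eq (α : E ≃ₜ E).continuous (β : E ≃ₜ E).continuous
    (funext fun x => (α.2 x).trans (β.2 x).symm) e h
  exact Subtype.ext (Homeomorph.ext fun x => congrFun h1 x)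

/-- The covering transformations of a simply connected covering act transitively on fibres. -/
lemma exists_deck_apply_eq [SimplyConnectedSpace E] [LocallyPathConnectedSpace E]
    (hp : IsCoveringMap p) {e e' : E} (h : p e = p e') : ∃ α : Deck p, (α : E ≃ₜ E) e = e' := by
  obtain ⟨F, ⟨hF, hpF⟩, -⟩ := hp.existsUnique_continuousMap_lifts ⟨p, hp.continuous⟩ e e' h.symm
  obtain ⟨G, ⟨hG, hpG⟩, -⟩ := hp.existsUnique_continuousMap_lifts ⟨p, hp.continuous⟩ e' e h
  have hpF' : ∀ x, p (F x) = p x := fun x => congrFun hpF x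
  have hpG' : ∀ x, p (G x) = p x := fun x => congrFun hpG x
  have hGF : G ∘ F = id := hp.eq_of_comp_eq (G.continuous.comp F.continuous) continuous_id
    (funext fun x => by simp [hpF', hpG']) e (by simp [hF, hG])
  have hFG : F ∘ G = id := hp.eq_of_comp_eq (F.continuous.comp G.continuous) continuous_id
    (funext fun x => by simp [hpF', hpG']) e' (by simp [hF, hG])
  refine ⟨⟨⟨⟨F, G, congrFun hGF, congrFun hFG⟩, F.continuous, G.continuous⟩, ?_⟩, hF⟩
  exact hpF'

lemma isLocallyInjective_orbitProj [T2Space X] (hp : IsCoveringMap p) :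
    IsLocallyInjective (orbitProj n p) := by
  intro x
  obtain ⟨D, hD, hDd⟩ := (finite_range (p ∘ x.1)).t2_separation
  have hloc : ∀ k, ∃ U, IsOpen U ∧ x.1 k ∈ U ∧ InjOn p U := fun k =>
    hp.isLocalHomeomorph.isLocallyInjective (x.1 k)
  choose U hU hxU hinj using hloc
  refine ⟨{y | ∀ k, y.1 k ∈ U k ∩ p ⁻¹' D (p (x.1 k))}, ?_, fun k => ⟨hxU k, (hD _).1⟩, ?_⟩
  · simp only [ofPred_forall]
    exact isOpen_iInter_of_finite fun k => ((hU k).inter ((hD _).2.preimage hp.continuous)).preimage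
      ((continuous_apply k).comp continuous_subtype_val)
  · intro y hy z hz hyz
    rw [orbitProj_eq_unorder, orbitProj_eq_unorder, unorder_eq_iff] at hyz
    obtain ⟨σ, hσ⟩ := hyz
    refine Subtype.ext (funext fun k => hinj k (hy k).1 (hz k).1 ?_)
    have h1 : p (z.1 k) = p (y.1 (σ k)) := congrFun hσ k
    have h2 : σ k = k := by
      by_contra hne
      refine Set.disjoint_left.1 (hDd ⟨σ k, rfl⟩ ⟨k, rfl⟩ fun h => hne (x.2 h)) ?_ (hz k).2
      rw [h1]; exact (hy (σ k)).2
    rw [h1, h2]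

/-- Uniqueness of lifts through `orbitProj`. -/
lemma eq_of_orbitProj_comp_eq [T2Space X] (hp : IsCoveringMap p) {A : Type*} [TopologicalSpace A]
    [PreconnectedSpace A] {u v : A → OrbitConf n p} (hu : Continuous u) (hv : Continuous v)
    (h : ∀ a, orbitProj n p (u a) = orbitProj n p (v a)) {a : A} (ha : u a = v a) : u = v := by
  have := t2Space_of_isCoveringMap hp
  exact (T2Space.isSeparatedMap (orbitProj n p)).eq_of_comp_eq (isLocallyInjective_orbitProj hp)
    hu hv (funext h) a ha

/-- The defining property of `inducedMap`. -/
lemma inducedMap_spec [T2Space X] [SimplyConnectedSpace E] [LocallyPathConnectedSpace E]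
    (hp : IsCoveringMap p) {f : X → UConf n X} {F : E → OrbitConf n p} (hFc : Continuous F)
    (hF : ∀ e, orbitProj n p (F e) = f (p e)) (γ : Deck p) (e : E) :
    F ((γ : E ≃ₜ E) e) = wreathAct (inducedMap F γ) (F e) := by
  refine Classical.epsilon_spec
    (p := fun a : Wreath n (Deck p) => ∀ e : E, F ((γ : E ≃ₜ E) e) = wreathAct a (F e)) ?_ e
  have h1 : orbitProj n p (F e) = orbitProj n p (F ((γ : E ≃ₜ E) e)) := by
    rw [hF, hF, γ.2]
  rw [orbitProj_eq_unorder, orbitProj_eq_unorder, unorder_eq_iff] at h1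
  obtain ⟨σ, hσ⟩ := h1
  have h2 : ∀ k, ∃ α : Deck p, (α : E ≃ₜ E) ((F e).1 (σ k)) = (F ((γ : E ≃ₜ E) e)).1 k :=
    fun k => exists_deck_apply_eq hp (congrFun hσ k).symm
  choose α hα using h2
  refine ⟨⟨α, σ⁻¹⟩, congrFun (eq_of_orbitProj_comp_eq hp (hFc.comp (γ : E ≃ₜ E).continuous)
    ((continuous_wreathAct _).comp hFc) (fun x => ?_) (a := e) ?_)⟩
  · rw [orbitProj_wreathAct, hF, hF, γ.2]
  · refine Subtype.ext (funext fun k => ?_)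
    simp [wreathAct, hα]

/-- The induced map is constant along a lifted homotopy. -/
lemma inducedMap_eq_of_homotopy [T2Space X] (hp : IsCoveringMap p)
    {A : Type*} [TopologicalSpace A] [PreconnectedSpace A] {L : A → E → OrbitConf n p}
    (hL : ∀ e, Continuous fun t => L t e) {H : A → X → UConf n X}
    (hLH : ∀ t e, orbitProj n p (L t e) = H t (p e)) (t t' : A) :
    inducedMap (L t) = inducedMap (L t') := by
  -- The defining property of the value at `γ` holds at all stages or at none.
  have key : ∀ t t' : A, ∀ γ : Deck p, ∀ a : Wreath n (Deck p),
      (∀ e : E, L t ((γ : E ≃ₜ E) e) = wreathAct a (L t e)) →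
        ∀ e : E, L t' ((γ : E ≃ₜ E) e) = wreathAct a (L t' e) := by
    intro t t' γ a h e
    refine congrFun (eq_of_orbitProj_comp_eq hp (hL ((γ : E ≃ₜ E) e))
      ((continuous_wreathAct a).comp (hL e)) (fun s => ?_) (a := t) (h e)) t'
    simp only [Function.comp_apply]
    rw [orbitProj_wreathAct, hLH, hLH, γ.2]
  funext γ
  refine congrArg Classical.epsilon (funext fun a => propext ⟨key t t' γ a, key t' t γ a⟩)

end Coverings

/-! ### Fixed point classes -/

section FixedPointClasses

variable {X E : Type*} [TopologicalSpace E] {p : E → X} {n : ℕ}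

lemma mem_pFix {F : E → OrbitConf n p} {α : Deck p} {k : Fin n} {x : X} :
    x ∈ pFix F α k ↔ ∃ e, (F e).1 k = (α : E ≃ₜ E) e ∧ p e = x := by
  have : ∀ e, ((α⁻¹ : Deck p) : E ≃ₜ E) ((F e).1 k) = e ↔ (F e).1 k = (α : E ≃ₜ E) e := fun e =>
    (α : E ≃ₜ E).symm_apply_eq
  simp only [pFix, mem_image, mem_ofPred_eq, this]

/-- The fixed point class of a Reidemeister class of an arbitrary map `Φ` in the place of
`inducedMap F`. -/
def fixClassOf (Φ : Deck p → Wreath n (Deck p)) (F : E → OrbitConf n p)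
    (c : ReidemeisterClass Φ) : Set X :=
  {x | ∃ α k, ReidemeisterClass.mk Φ α k = c ∧ x ∈ pFix F α k}

lemma fixClassOf_subset_fixSet {Φ : Deck p → Wreath n (Deck p)} {f : X → UConf n X}
    {F : E → OrbitConf n p} (hF : ∀ e, orbitProj n p (F e) = f (p e)) (c : ReidemeisterClass Φ) :
    fixClassOf Φ F c ⊆ fixSet f := by
  rintro x ⟨α, k, -, hx⟩
  obtain ⟨e, he, rfl⟩ := mem_pFix.1 hx
  change p e ∈ (f (p e)).toSet
  rw [← hF, mem_toSet_orbitProj]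
  exact ⟨k, by rw [he]; exact α.2 e⟩

variable [TopologicalSpace X]

/-- Every fixed point lies in a fixed point class. -/
lemma exists_mem_fixClassOf [SimplyConnectedSpace E] [LocallyPathConnectedSpace E]
    (hp : IsCoveringMap p) (hps : Function.Surjective p) (Φ : Deck p → Wreath n (Deck p))
    {f : X → UConf n X} {F : E → OrbitConf n p} (hF : ∀ e, orbitProj n p (F e) = f (p e))
    {x : X} (hx : x ∈ fixSet f) : ∃ c, x ∈ fixClassOf Φ F c := by
  obtain ⟨e, rfl⟩ := hps x
  have hx' : p e ∈ (f (p e)).toSet := hx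
  rw [← hF, mem_toSet_orbitProj] at hx'
  obtain ⟨k, hk⟩ := hx'
  obtain ⟨α, hα⟩ := exists_deck_apply_eq hp hk.symm
  exact ⟨_, α, k, rfl, mem_pFix.2 ⟨e, hα.symm, rfl⟩⟩

/-- Distinct Reidemeister classes have disjoint fixed point classes. -/
lemma eq_of_mem_fixClassOf [SimplyConnectedSpace E] [LocallyPathConnectedSpace E]
    (hp : IsCoveringMap p) {Φ : Deck p → Wreath n (Deck p)} {F : E → OrbitConf n p}
    (hΦ : ∀ (γ : Deck p) e, F ((γ : E ≃ₜ E) e) = wreathAct (Φ γ) (F e))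
    {c c' : ReidemeisterClass Φ} {x : X} (hx : x ∈ fixClassOf Φ F c)
    (hx' : x ∈ fixClassOf Φ F c') : c = c' := by
  obtain ⟨α, k, rfl, hx⟩ := hx
  obtain ⟨β, j, rfl, hx'⟩ := hx'
  obtain ⟨e, he, rfl⟩ := mem_pFix.1 hx
  obtain ⟨e', he', hpe⟩ := mem_pFix.1 hx'
  obtain ⟨γ, rfl⟩ := exists_deck_apply_eq hp hpe.symm
  rw [hΦ γ e] at he'
  have he'' : ((Φ γ).left j : E ≃ₜ E) ((F e).1 ((Φ γ).right⁻¹ j)) =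
    (β : E ≃ₜ E) ((γ : E ≃ₜ E) e) := he'
  have hk : (Φ γ).right⁻¹ j = k := by
    refine (F e).2 ?_
    change p _ = p _
    rw [he, α.2, ← ((Φ γ).left j).2, he'', β.2, γ.2]
  rw [hk, he] at he''
  have h1 : (Φ γ).left j * α = β * γ := deck_ext hp he''
  refine Quot.sound ⟨γ, ?_, ?_⟩
  · simp [← hk]
  · simp only [mul_assoc]
    rw [← h1]; simp

variable {A : Type*} [TopologicalSpace A] {H : A × X → UConf n X} {L : A × E → OrbitConf n p}

/-- In a lifted homotopy, fixed points near a fixed point belong to the same class. -/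
lemma eventually_mem_fixClassOf [T2Space X] (hp : IsCoveringMap p) (hps : Function.Surjective p)
    {Φ : Deck p → Wreath n (Deck p)} (hL : Continuous L)
    (hLH : ∀ t e, orbitProj n p (L (t, e)) = H (t, p e)) {c : ReidemeisterClass Φ} {t₀ : A} {x₀ : X}
    (hx₀ : x₀ ∈ fixClassOf Φ (fun e => L (t₀, e)) c) :
    ∀ᶠ q in 𝓝 (t₀, x₀), q.2 ∈ (H q).toSet → q.2 ∈ fixClassOf Φ (fun e => L (q.1, e)) c := by
  obtain ⟨α, k, hc, hx⟩ := hx₀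
  obtain ⟨e₀, he₀, rfl⟩ := mem_pFix.1 hx
  obtain ⟨U, hU, he₀U, hinj⟩ := hp.isLocalHomeomorph.isLocallyInjective e₀
  have hcoord : ∀ j, Continuous fun q : A × E => (L q).1 j := fun j =>
    (continuous_apply j).comp (continuous_subtype_val.comp hL)
  -- Near `(t₀, e₀)` only the `k`-th coordinate of the lift can lie over a fixed point, and `α⁻¹`
  -- brings it into the sheet `U`.
  have hpn : ∀ᶠ q in 𝓝 (t₀, e₀), q.2 ∈ U ∧ ((α⁻¹ : Deck p) : E ≃ₜ E) ((L q).1 k) ∈ U ∧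
      ∀ j, j ≠ k → p ((L q).1 j) ≠ p q.2 := by
    refine (continuous_snd.continuousAt.eventually (hU.mem_nhds he₀U)).and
      (((((α⁻¹ : Deck p) : E ≃ₜ E).continuous.comp (hcoord k)).continuousAt.eventually
        (hU.mem_nhds ?_)).and (eventually_all.2 fun j => ?_))
    · have : ((α⁻¹ : Deck p) : E ≃ₜ E) ((L (t₀, e₀)).1 k) = e₀ :=
        ((α : E ≃ₜ E).symm_apply_eq).2 he₀
      simp only [Function.comp_apply]
      rwa [this]
    · by_cases hj : j = k
      · simp [hj]
      · have hne : p ((L (t₀, e₀)).1 j) ≠ p e₀ := by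
          intro h
          refine hj ((L (t₀, e₀)).2 (h.trans ?_))
          change _ = p ((L (t₀, e₀)).1 k)
          rw [he₀, α.2]
        exact Eventually.mono ((isOpen_ne_fun (hp.continuous.comp (hcoord j)) (hp.continuous.comp
          continuous_snd)).mem_nhds hne) fun q hq _ => hq
  have hopen : IsOpenQuotientMap (Prod.map id p : A × E → A × X) :=
    IsOpenQuotientMap.id.prodMap ⟨hps, hp.continuous, hp.isOpenMap⟩
  have himg := hopen.isOpenMap.image_mem_nhds hpn
  refine mem_of_superset himg ?_
  rintro _ ⟨⟨t, e⟩, ⟨heU, hαU, hne⟩, rfl⟩ hfix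
  have hfix' : p e ∈ (H (t, p e)).toSet := hfix
  rw [← hLH, mem_toSet_orbitProj] at hfix'
  obtain ⟨j, hj⟩ := hfix'
  have hjk : j = k := by
    by_contra h
    exact hne j h hj
  subst hjk
  refine ⟨α, j, hc, mem_pFix.2 ⟨e, ?_, rfl⟩⟩
  have h1 : ((α⁻¹ : Deck p) : E ≃ₜ E) ((L (t, e)).1 j) = e :=
    hinj hαU heU (((α⁻¹ : Deck p).2 _).trans hj)
  exact ((α : E ≃ₜ E).symm_apply_eq).1 h1

lemma isClosed_fixed_points [T2Space X] (hH : Continuous H) :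
    IsClosed {q : A × X | q.2 ∈ (H q).toSet} :=
  isClosed_mem_toSet.preimage (continuous_snd.prodMk hH)

lemma isOpen_compl_other_classes [T2Space X] (hp : IsCoveringMap p)
    (hps : Function.Surjective p) {Φ : Deck p → Wreath n (Deck p)} (hH : Continuous H)
    (hL : Continuous L) (hLH : ∀ t e, orbitProj n p (L (t, e)) = H (t, p e))
    (c : ReidemeisterClass Φ) :
    IsOpen {q : A × X | q.2 ∈ (H q).toSet → q.2 ∈ fixClassOf Φ (fun e => L (q.1, e)) c} := by
  rw [isOpen_iff_mem_nhds]
  rintro ⟨t, x⟩ hq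
  by_cases hx : x ∈ (H (t, x)).toSet
  · exact eventually_mem_fixClassOf hp hps hL hLH (hq hx)
  · filter_upwards [(isClosed_fixed_points hH).isOpen_compl.mem_nhds hx] with q' hq' h
    exact absurd h hq'

/-- The total space of a fixed point class in a lifted homotopy is closed. -/
lemma isClosed_fixClassOf [T2Space X] [SimplyConnectedSpace E] [LocallyPathConnectedSpace E]
    (hp : IsCoveringMap p) (hps : Function.Surjective p) {Φ : Deck p → Wreath n (Deck p)}
    (hΦ : ∀ t (γ : Deck p) e, L (t, (γ : E ≃ₜ E) e) = wreathAct (Φ γ) (L (t, e)))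
    (hH : Continuous H) (hL : Continuous L)
    (hLH : ∀ t e, orbitProj n p (L (t, e)) = H (t, p e)) (c : ReidemeisterClass Φ) :
    IsClosed {q : A × X | q.2 ∈ fixClassOf Φ (fun e => L (q.1, e)) c} := by
  rw [← isOpen_compl_iff, isOpen_iff_mem_nhds]
  rintro ⟨t, x⟩ hq
  have hsub : ∀ q : A × X, q.2 ∈ fixClassOf Φ (fun e => L (q.1, e)) c → q.2 ∈ (H q).toSet :=
    fun q hq' => fixClassOf_subset_fixSet (f := fun x => H (q.1, x)) (hLH q.1) c hq'
  by_cases hx : x ∈ (H (t, x)).toSet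
  · obtain ⟨c', hc'⟩ := exists_mem_fixClassOf hp hps Φ (f := fun x => H (t, x)) (hLH t) hx
    filter_upwards [eventually_mem_fixClassOf hp hps hL hLH hc'] with q' hq' h
    have hcc : c' = c := eq_of_mem_fixClassOf hp (hΦ q'.1) (hq' (hsub q' h)) h
    exact hq (hcc ▸ hc')
  · filter_upwards [(isClosed_fixed_points hH).isOpen_compl.mem_nhds hx] with q' hq' h
    exact hq' (hsub q' h)

end FixedPointClasses

/-! ### Homotopy invariance of the index -/

section IndexInvariance

variable {X V : Type*} [TopologicalSpace X] [Fintype V] {n : ℕ}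

open Classical in
/-- The neighbourhood retraction onto the triangulated space, extended by a junk value. -/
noncomputable def retraction [Nonempty X] (T : Triangulation X V) (y : V → ℝ) : X :=
  if h : y ∈ retractDomain T.complex then T.homeo.symm (retract T.complex ⟨y, h⟩)
  else Classical.arbitrary X

lemma retraction_of_mem [Nonempty X] (T : Triangulation X V) {y : V → ℝ}
    (h : y ∈ retractDomain T.complex) :
    retraction T y = T.homeo.symm (retract T.complex ⟨y, h⟩) := dif_pos h

lemma continuousOn_retraction [Nonempty X] (T : Triangulation X V) :
    ContinuousOn (retraction T) (retractDomain T.complex) := by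
  rw [continuousOn_iff_continuous_domRestrict]
  refine (T.homeo.symm.continuous.comp (continuous_retract T.complex)).congr fun y => ?_
  exact (retraction_of_mem T y.2).symm

lemma retraction_homeo [Nonempty X] (T : Triangulation X V) (x : X) :
    retraction T (T.homeo x).1 = x := by
  rw [retraction_of_mem T (realization_subset_retractDomain _ (T.homeo x).2), retract_eq_self,
    T.homeo.symm_apply_apply]

lemma mem_thicken [Nonempty X] (T : Triangulation X V) {W : Set X} {y : V → ℝ} :
    y ∈ thicken T W ↔ y ∈ retractDomain T.complex ∧ retraction T y ∈ W := by
  constructor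
  · rintro ⟨h, hy⟩
    exact ⟨h, by rwa [retraction_of_mem T h]⟩
  · rintro ⟨h, hy⟩
    exact ⟨h, by rwa [retraction_of_mem T h] at hy⟩

lemma displacement_of_mem [Nonempty X] (T : Triangulation X V) (s : X → X) {y : V → ℝ}
    (h : y ∈ retractDomain T.complex) :
    displacement T s y = y - (T.homeo (s (retraction T y))).1 := by
  rw [displacement, dif_pos h, retraction_of_mem T h]

lemma isOpen_thicken (T : Triangulation X V) [Nonempty X] {W : Set X} (hW : IsOpen W) :
    IsOpen (thicken T W) := by
  have : thicken T W = retractDomain T.complex ∩ retraction T ⁻¹' W := by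
    ext y; exact mem_thicken T
  rw [this]
  exact (continuousOn_retraction T).isOpen_inter_preimage (isOpen_retractDomain _) hW

/-- The zeros of the displacement are the fixed points. -/
lemma thicken_inter_zeros [Nonempty X] (T : Triangulation X V) (s : X → X) (W : Set X) :
    thicken T W ∩ displacement T s ⁻¹' {0} =
      (fun x => (T.homeo x).1) '' {x | x ∈ W ∧ s x = x} := by
  ext y
  constructor
  · rintro ⟨hy, h0⟩
    obtain ⟨h, hW⟩ := (mem_thicken T).1 hy
    have h0' : displacement T s y = 0 := h0
    rw [displacement_of_mem T s h, sub_eq_zero] at h0'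
    have hr : retraction T y = s (retraction T y) := by
      conv_lhs => rw [h0', retraction_homeo]
    exact ⟨retraction T y, ⟨hW, hr.symm⟩, by simp only; rw [hr]; exact h0'.symm⟩
  · rintro ⟨x, ⟨hW, hs⟩, rfl⟩
    have h := realization_subset_retractDomain T.complex (T.homeo x).2
    refine ⟨(mem_thicken T).2 ⟨h, by rwa [retraction_homeo]⟩, ?_⟩
    change displacement T s _ = 0
    rw [displacement_of_mem T s h, retraction_homeo, hs, sub_self]

lemma IsFixedBranch.fixed_eq {f : X → UConf n X} {U W : Set X} {s : X → X}
    (h : IsFixedBranch f U W s) : {x | x ∈ W ∧ s x = x} = fixSet f ∩ U := by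
  ext x
  refine ⟨fun ⟨hW, hs⟩ => ⟨?_, h.subset hW⟩, fun hx => ⟨h.fixSet_subset hx, h.fixed x hx⟩⟩
  have := h.mem x hW
  rwa [hs] at this

/-- Two selections of an `n`-valued map through the same fixed points agree near them, since nearby
configurations have only one point near each of these. -/
lemma IsFixedBranch.eventually_eq [T2Space X] {f : X → UConf n X} (hf : Continuous f)
    {U W W' : Set X} {s s' : X → X} (h : IsFixedBranch f U W s) (h' : IsFixedBranch f U W' s')
    {x : X} (hx : x ∈ fixSet f ∩ U) : ∀ᶠ y in 𝓝 x, y ∈ W ∧ y ∈ W' ∧ s y = s' y := by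
  obtain ⟨O, hO, Q, hQ, hsub⟩ := exists_nhds_toSet_subsingleton (q := f x) (y := x) hx.1
  have hW := h.isOpen.mem_nhds (h.fixSet_subset hx)
  have hW' := h'.isOpen.mem_nhds (h'.fixSet_subset hx)
  have hs : ∀ᶠ y in 𝓝 x, s y ∈ O :=
    (h.continuousOn.continuousAt hW).preimage_mem_nhds (by rwa [h.fixed x hx])
  have hs' : ∀ᶠ y in 𝓝 x, s' y ∈ O :=
    (h'.continuousOn.continuousAt hW').preimage_mem_nhds (by rwa [h'.fixed x hx])
  filter_upwards [hW, hW', hs, hs', hf.continuousAt.preimage_mem_nhds hQ] with y h1 h2 h3 h4 h5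
  exact ⟨h1, h2, hsub _ h5 ⟨h3, h.mem y h1⟩ ⟨h4, h'.mem y h2⟩⟩

theorem IsFixedPointIndex.unique [Nonempty X] [T2Space X] {T : Triangulation X V}
    {f : X → UConf n X} (hf : Continuous f) {U : Set X} {d d' : ℤ}
    (h : IsFixedPointIndex T f U d) (h' : IsFixedPointIndex T f U d') : d = d' := by
  obtain ⟨W, s, hs, hd⟩ := h
  obtain ⟨W', s', hs', hd'⟩ := h'
  refine hd.eq_of_eqOn hd' (isOpen_thicken T isOpen_interior
    (W := interior {y | y ∈ W ∧ y ∈ W' ∧ s y = s' y})) ?_ ?_ ?_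
  · rw [thicken_inter_zeros, hs.fixed_eq]
    rintro _ ⟨x, hx, rfl⟩
    refine (mem_thicken T).2 ⟨realization_subset_retractDomain T.complex (T.homeo x).2, ?_⟩
    rw [retraction_homeo, mem_interior_iff_mem_nhds]
    exact hs.eventually_eq hf hs' hx
  · rw [thicken_inter_zeros, thicken_inter_zeros, hs.fixed_eq, hs'.fixed_eq]
  · intro y hy
    obtain ⟨h1, h2⟩ := (mem_thicken T).1 hy
    rw [displacement_of_mem T s h1, displacement_of_mem T s' h1, (interior_subset h2).2.2]

lemma IsFixedPointIndex.index_eq [Nonempty X] [T2Space X] {T : Triangulation X V}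
    {f : X → UConf n X} (hf : Continuous f) {U : Set X} {d : ℤ} (h : IsFixedPointIndex T f U d) :
    index T f U = d := by
  have hex : ∃ d, IsFixedPointIndex T f U d := ⟨d, h⟩
  rw [index, dif_pos hex]
  exact hex.choose_spec.unique hf h

/-- Homotopy invariance of the fixed point index, for a set of fixed points that stays separated
from the other ones during the homotopy. -/
theorem index_eq_of_homotopy [Nonempty X] (T : Triangulation X V) {A : Type*} [TopologicalSpace A]
    [CompactSpace A] [T2Space A] [PreconnectedSpace A] {H : A × X → UConf n X} (hH : Continuous H)
    {O : Set (A × X)} (hO : IsOpen O) (hC : IsClosed ({q : A × X | q.2 ∈ (H q).toSet} ∩ O))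
    (t t' : A) :
    index T (fun x => H (t, x)) {x | (t, x) ∈ O} =
      index T (fun x => H (t', x)) {x | (t', x) ∈ O} := by
  have := T.compactSpace
  have := T.t2Space
  have := T.metrizableSpace
  have hHt : ∀ t, Continuous fun x => H (t, x) := fun t => hH.comp (by fun_prop)
  obtain ⟨B, s, hB, hs, hsmem, hsfix⟩ := exists_nearest_selection n X
  have hpair : Continuous fun q : A × X => (q.2, H q) := continuous_snd.prodMk hH
  -- One branch `σ` on `W` serves all stages of the homotopy.
  set W : Set (A × X) := O ∩ (fun q : A × X => (q.2, H q)) ⁻¹' B with hW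
  have hWo : IsOpen W := hO.inter (hB.preimage hpair)
  set σ : A → X → X := fun t x => s (x, H (t, x)) with hσ
  have hσc : ContinuousOn (Function.uncurry σ) W :=
    hs.comp hpair.continuousOn fun q hq => hq.2
  have hbranch : ∀ t, IsFixedBranch (fun x => H (t, x)) {x | (t, x) ∈ O} {x | (t, x) ∈ W} (σ t) :=
    fun t =>
    { isOpen := hWo.preimage (by fun_prop : Continuous fun x => (t, x))
      subset := fun x hx => hx.1
      fixSet_subset := fun x hx => ⟨hx.2, (hsfix x _ hx.1).1⟩
      continuousOn := hσc.comp (f := fun x => (t, x)) (by fun_prop) fun x hx => hx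
      mem := fun x hx => hsmem _ hx.2
      fixed := fun x hx => (hsfix x _ hx.1).2 }
  set Ω : Set (A × (V → ℝ)) := {q | q.2 ∈ thicken T {x | (q.1, x) ∈ W}} with hΩ
  set ψ : A → (V → ℝ) → (V → ℝ) := fun t => displacement T (σ t) with hψ
  have hDc : ContinuousOn (fun q : A × (V → ℝ) => (q.1, retraction T q.2))
      (univ ×ˢ retractDomain T.complex) :=
    continuousOn_fst.prodMk ((continuousOn_retraction T).comp continuousOn_snd fun q hq => hq.2)
  have hΩeq : Ω = (univ ×ˢ retractDomain T.complex) ∩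
      (fun q : A × (V → ℝ) => (q.1, retraction T q.2)) ⁻¹' W := by
    ext q
    simp only [hΩ, mem_ofPred_eq, mem_thicken T, mem_inter_iff, mem_prod, mem_univ, true_and,
      mem_preimage]
  have hΩo : IsOpen Ω := by
    rw [hΩeq]
    exact hDc.isOpen_inter_preimage (isOpen_univ.prod (isOpen_retractDomain _)) hWo
  have hψc : ContinuousOn (Function.uncurry ψ) Ω := by
    have h1 : ContinuousOn (fun q : A × (V → ℝ) =>
        q.2 - (T.homeo (Function.uncurry σ (q.1, retraction T q.2))).1) Ω := by
      refine continuousOn_snd.sub (continuous_subtype_val.comp_continuousOn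
        (T.homeo.continuous.comp_continuousOn (hσc.comp (hDc.mono ?_) ?_)))
      · rw [hΩeq]; exact inter_subset_left
      · intro q hq
        rw [hΩeq] at hq
        exact hq.2
    refine h1.congr fun q hq => ?_
    exact displacement_of_mem T _ ((mem_thicken T).1 hq).1
  have hhomeo : Continuous fun q : A × X => (q.1, (T.homeo q.2).1) := by fun_prop
  have hZ : Ω ∩ Function.uncurry ψ ⁻¹' {0} = (fun q : A × X => (q.1, (T.homeo q.2).1)) ''
      ({q : A × X | q.2 ∈ (H q).toSet} ∩ O) := by
    ext ⟨t, y⟩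
    have h1 : (t, y) ∈ Ω ∩ Function.uncurry ψ ⁻¹' {0} ↔
        y ∈ thicken T {x | (t, x) ∈ W} ∩ displacement T (σ t) ⁻¹' {0} := Iff.rfl
    rw [h1, thicken_inter_zeros, (hbranch t).fixed_eq]
    constructor
    · rintro ⟨x, hx, rfl⟩
      exact ⟨(t, x), hx, rfl⟩
    · rintro ⟨⟨t', x⟩, hx, heq⟩
      obtain ⟨rfl, rfl⟩ := Prod.mk.inj heq
      exact ⟨x, hx, rfl⟩
  have hZc : IsCompact (Ω ∩ Function.uncurry ψ ⁻¹' {0}) := by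
    rw [hZ]; exact hC.isCompact.image hhomeo
  have hloc : IsLocallyConstant fun t => index T (fun x => H (t, x)) {x | (t, x) ∈ O} := by
    rw [IsLocallyConstant.iff_eventually_eq]
    intro t
    have hslice : IsCompact (thicken T {x | (t, x) ∈ W} ∩ displacement T (σ t) ⁻¹' {0}) := by
      rw [thicken_inter_zeros, (hbranch t).fixed_eq]
      exact ((hC.preimage (by fun_prop : Continuous fun x => (t, x))).isCompact).image (by fun_prop)
    obtain ⟨d, hd⟩ := exists_isBrouwerDegree (isOpen_thicken T (hbranch t).isOpen)
      (hψc.comp (f := fun y => (t, y)) (by fun_prop) fun y hy => hy) hslice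
    have hd0 : index T (fun x => H (t, x)) {x | (t, x) ∈ O} = d :=
      IsFixedPointIndex.index_eq (hHt t) ⟨_, _, hbranch t, hd⟩
    filter_upwards [IsBrouwerDegree.eventually hΩo hψc hZc (t₀ := t) (d := d) hd] with t' ht'
    rw [hd0]
    exact IsFixedPointIndex.index_eq (hHt t') ⟨_, _, hbranch t', ht'⟩
  exact hloc.apply_eq_of_preconnectedSpace t t'

end IndexInvariance

/-! ### Homotopy invariance of the Reidemeister trace -/

section TraceInvariance

variable {X E : Type*} [TopologicalSpace E] {p : E → X} {n : ℕ}

/-- The identification of the Reidemeister classes of equal maps. -/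
def reidemeisterEquiv {G : Type*} [Group G] {Φ Ψ : G → Wreath n G} (h : Φ = Ψ) :
    ReidemeisterClass Φ ≃ ReidemeisterClass Ψ :=
  Quot.congr (Equiv.refl (G × Fin n)) (fun a b => by subst h; rfl)

lemma fixClassOf_reidemeisterEquiv {Φ Ψ : Deck p → Wreath n (Deck p)} (h : Φ = Ψ)
    (F : E → OrbitConf n p) (c : ReidemeisterClass Φ) :
    fixClassOf Ψ F (reidemeisterEquiv h c) = fixClassOf Φ F c := by
  subst h
  have : reidemeisterEquiv (rfl : Φ = Φ) c = c := by
    induction c using Quot.ind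
    rfl
  rw [this]

end TraceInvariance

end NValued

open NValued in
theorem mainTheorem5 {X E V : Type*} [TopologicalSpace X] [ConnectedSpace X] [Fintype V]
    (T : NValued.Triangulation X V)
    [TopologicalSpace E] [SimplyConnectedSpace E] (p : E → X) (hp : IsCoveringMap p)
    (n : ℕ) (f g : C(X, NValued.UConf n X)) (H : f.Homotopy g)
    (F G : C(E, NValued.OrbitConf n p))
    (hF : ∀ e, NValued.orbitProj n p (F e) = f (p e))
    (L : F.Homotopy G)
    (hL : ∀ (t : unitInterval) (e : E), NValued.orbitProj n p (L (t, e)) = H (t, p e)) :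
    ∃ h : NValued.inducedMap F = NValued.inducedMap G,
      NValued.reidemeisterIdent h (NValued.reidemeisterTrace T f F) =
        NValued.reidemeisterTrace T g G := by
  have := T.t2Space
  have := T.locallyPathConnectedSpace
  have := locallyPathConnectedSpace_of_isLocalHomeomorph hp.isLocalHomeomorph
  have : PathConnectedSpace X := pathConnectedSpace_iff_connectedSpace.2 inferInstance
  have hps : Function.Surjective p := surjective_of_isCoveringMap hp
  have hHc : Continuous fun q : unitInterval × X => H q := H.continuous
  have hLc : Continuous fun q : unitInterval × E => L q := L.continuous
  have hL0 : (fun e => L (0, e)) = F := funext L.apply_zero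
  have hL1 : (fun e => L (1, e)) = G := funext L.apply_one
  have hH0 : (fun x => H (0, x)) = f := funext H.apply_zero
  have hH1 : (fun x => H (1, x)) = g := funext H.apply_one
  have hind : ∀ t, inducedMap (fun e => L (t, e)) = inducedMap F := by
    intro t
    rw [inducedMap_eq_of_homotopy hp (L := fun t e => L (t, e)) (H := fun t x => H (t, x))
      (fun e => hLc.comp (by fun_prop)) hL t 0, hL0]
  have h : inducedMap F = inducedMap G := by rw [← hind 1, hL1]
  have hΦ : ∀ t (γ : Deck p) e, L (t, (γ : E ≃ₜ E) e) = wreathAct (inducedMap F γ) (L (t, e)) := by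
    intro t γ e
    rw [← hind t]
    exact inducedMap_spec hp (f := fun x => H (t, x)) (F := fun e => L (t, e))
      (hLc.comp (by fun_prop)) (hL t) γ e
  -- The indices of corresponding fixed point classes agree.
  have hindex : ∀ c, index T f (classNhd f F c) =
      index T g (classNhd g G (reidemeisterEquiv h c)) := by
    intro c
    -- The slices of `O` are the neighbourhoods `classNhd` of the class at each stage.
    set O : Set (unitInterval × X) :=
      {q | q.2 ∈ (H q).toSet → q.2 ∈ fixClassOf (inducedMap F) (fun e => L (q.1, e)) c} with hO
    have hOo : IsOpen O := isOpen_compl_other_classes hp hps hHc hLc hL c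
    have hC : IsClosed ({q : unitInterval × X | q.2 ∈ (H q).toSet} ∩ O) := by
      convert isClosed_fixClassOf hp hps hΦ hHc hLc hL c using 1
      ext q
      exact ⟨fun hq => hq.2 hq.1, fun hq => ⟨fixClassOf_subset_fixSet
        (f := fun x => H (q.1, x)) (hL q.1) c hq, fun _ => hq⟩⟩
    have hO0 : {x | (0, x) ∈ O} = classNhd f F c := by
      ext x
      change (x ∈ (H (0, x)).toSet → x ∈ fixClassOf (inducedMap F) (fun e => L (0, e)) c) ↔
        ¬ (x ∈ (f x).toSet ∧ x ∉ fixClassOf (inducedMap F) F c)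
      rw [hL0, H.apply_zero, not_and_not_right]
    have hO1 : {x | (1, x) ∈ O} = classNhd g G (reidemeisterEquiv h c) := by
      ext x
      change (x ∈ (H (1, x)).toSet → x ∈ fixClassOf (inducedMap F) (fun e => L (1, e)) c) ↔
        ¬ (x ∈ (g x).toSet ∧ x ∉ fixClassOf (inducedMap G) G (reidemeisterEquiv h c))
      rw [hL1, H.apply_one, not_and_not_right, fixClassOf_reidemeisterEquiv]
    have := index_eq_of_homotopy T hHc hOo hC 0 1
    rwa [hH0, hH1, hO0, hO1] at this
  refine ⟨h, ?_⟩
  rw [reidemeisterTrace, AddEquiv.map_finsum, reidemeisterTrace,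
    ← finsum_comp_equiv (reidemeisterEquiv h)]
  refine finsum_congr fun c => ?_
  rw [← hindex]
  change Finsupp.domCongr (reidemeisterEquiv h) _ = _
  simp
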